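/- For cardinals $\lambda\ge\mu\ge\sigma+\theta_0+\theta_1$, consider a colouring $c:[\lambda]^2\to\sigma$ and data of the following form: ordinals $i_0<\theta_0$, $i_1<\theta_1$ and, for $\iota=0,1$, a sequence $\langle\zeta^\iota_{\alpha,i}:\alpha<\mu,\ i<i_\iota\rangle$ without repetitions of ordinals below $\lambda$, such that the two sequences have disjoint ranges. Let $\mathrm{Pr}_1(\lambda,\mu,\sigma,(\theta_0,\theta_1))$ say that there is a colouring $c:[\lambda]^2\to\sigma$ such that for all such data and every $\gamma<\sigma$ there are $\alpha_0<\alpha_1<\mu$ with $c\{\zeta^0_{\alpha_0,i},\zeta^1_{\alpha_1,j}\}=\gamma$ for all $i<i_0$, $j<i_1$. Let $\mathrm{Pr}_{0,0}(\lambda,\mu,\sigma,(\theta_0,\theta_1))$ say that there is a colouring $c:[\lambda]^2\to\sigma$ such that for all such data and every function $h:i_0\to\sigma$ there are $\alpha_0<\alpha_1<\mu$ with $c\{\zeta^0_{\alpha_0,i},\zeta^1_{\alpha_1,j}\}=h(i)$ for all $i<i_0$, $j<i_1$. 1) If $\kappa$ is an infinite regular cardinal and $\lambda=\kappa^{+3}$,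 then $\mathrm{Pr}_1(\lambda,\lambda,\lambda,(\kappa,\kappa^+))$ holds, and (hence) $\mathrm{Pr}_{0,0}(\lambda,\lambda,\lambda,(\aleph_0,\kappa^+))$ holds. 2) The statement $(*)_{\aleph_3,\aleph_0}$ holds, that is, there is a topological space $X$ such that: (a) $X$ is $T_3$ (regular and Hausdorff), has a base of clopen sets, and has weight $\le\aleph_3$; (b) the closure of every set of at most $\aleph_0$ points of $X$ is compact; (c) every infinite discrete subset of $X$ (a subset whose subspace topology is discrete) has an accumulation point in $X$; (d) $X$ is not compact; (e) some non-isolated point of $X$ is not an accumulation point of any discrete subset of $X$. -/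

import Mathlib

open Cardinal Filter Topology

universe u

namespace StrongColouring

/-- The set of ordinals below the initial ordinal of the cardinal `c`, that is, the cardinal `c`
regarded as a set of ordinals. -/
abbrev Below (c : Cardinal.{u}) : Type (u + 1) := Set.Iio c.ord

/-- Two sequences `⟨ζ^ι_{α,i} : α < μ, i < i_ι⟩` (`ι = 0, 1`) of ordinals below `lam`, each without
repetitions, with disjoint ranges, where `i₀ < θ₀` and `i₁ < θ₁` are ordinals. -/
structure BlockPair (lam mu th0 th1 : Cardinal.{u}) where
  i₀ : Ordinal.{u}
  i₁ : Ordinal.{u}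
  i₀_lt : i₀ < th0.ord
  i₁_lt : i₁ < th1.ord
  ζ₀ : Below mu → Set.Iio i₀ → Below lam
  ζ₁ : Below mu → Set.Iio i₁ → Below lam
  ζ₀_inj : ∀ α β i j, ζ₀ α i = ζ₀ β j → α = β ∧ i = j
  ζ₁_inj : ∀ α β i j, ζ₁ α i = ζ₁ β j → α = β ∧ i = j
  disjoint : ∀ α β i j, ζ₀ α i ≠ ζ₁ β j

/-- `Pr₁(lam, mu, sig, (th0, th1))`, meant for `lam ≥ mu ≥ sig + th0 + th1`: some colouring `c` of
the unordered pairs from `lam` with `sig` colours is such that for all sequences of blocks as in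
`BlockPair` and every colour `γ` there are `α₀ < α₁ < mu` such that `c` is constantly `γ` on the
product of the `α₀`-th block of the first sequence and the `α₁`-th block of the second. (The value
of `c` on the diagonal of `Sym2` is irrelevant, since the two ranges are disjoint.) -/
def Pr1 (lam mu sig th0 th1 : Cardinal.{u}) : Prop :=
  ∃ c : Sym2 (Below lam) → Below sig,
    ∀ (b : BlockPair lam mu th0 th1) (γ : Below sig),
      ∃ α₀ α₁ : Below mu, α₀ < α₁ ∧
        ∀ (i : Set.Iio b.i₀) (j : Set.Iio b.i₁), c s(b.ζ₀ α₀ i, b.ζ₁ α₁ j) = γ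

/-- `Pr_{0,0}(lam, mu, sig, (th0, th1))`, meant for `lam ≥ mu ≥ sig + th0 + th1`: as `Pr1`, but the
colour to be realised at a pair is prescribed as a function `h` of the index in the first block. -/
def Pr00 (lam mu sig th0 th1 : Cardinal.{u}) : Prop :=
  ∃ c : Sym2 (Below lam) → Below sig,
    ∀ (b : BlockPair lam mu th0 th1) (h : Set.Iio b.i₀ → Below sig),
      ∃ α₀ α₁ : Below mu, α₀ < α₁ ∧
        ∀ (i : Set.Iio b.i₀) (j : Set.Iio b.i₁), c s(b.ζ₀ α₀ i, b.ζ₁ α₁ j) = h i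

/-- The weight of a topological space: the least cardinality of a base. -/
noncomputable def weight (X : Type u) [TopologicalSpace X] : Cardinal.{u} :=
  sInf {w | ∃ B : Set (Set X), TopologicalSpace.IsTopologicalBasis B ∧ #B = w}

/-- The topological statement `(*)_{lam, κ}`. -/
def TopStar (lam κ : Cardinal.{u}) : Prop :=
  ∃ (X : Type u) (_ : TopologicalSpace X),
    -- `X` is regular Hausdorff, has a base of clopen sets, and has weight at most `lam`
    (T3Space X ∧ TopologicalSpace.IsTopologicalBasis {s : Set X | IsClopen s} ∧ weight X ≤ lam) ∧
    -- the closure of any set of at most `κ` points is compact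
    (∀ A : Set X, #A ≤ κ → IsCompact (closure A)) ∧
    -- every infinite discrete set has an accumulation point
    (∀ D : Set X, D.Infinite → IsDiscrete D → ∃ x, AccPt x (𝓟 D)) ∧
    -- `X` is not compact
    ¬ CompactSpace X ∧
    -- some non-isolated point is not an accumulation point of any discrete set
    ∃ x : X, ¬ IsOpen ({x} : Set X) ∧ ∀ D : Set X, IsDiscrete D → ¬ AccPt x (𝓟 D)

end StrongColouring

/-!
# A strong colouring of the third successor, and a topological application

Let `λ = κ⁺⁺⁺`, `μ = κ⁺⁺` and `χ = κ⁺`. The colouring is read off from walks on ordinals. Every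
`x < λ` has an enumeration of its predecessors in type `μ`; the walk from `β` down to `α < β` moves
from a node `x > α` to the first entry of that enumeration which is at least `α`, and the index of
this entry is the *level* of `x` over `α`. If `δ` has cofinality above `χ`, then the walk from any
`β > δ` to a point `α < δ` close enough to `δ` passes through `δ`, and the levels of the nodes
above `δ` do not depend on `α` (`Enumerates.exists_passes`), whereas the level of `δ` itself over
`α` tends to `μ` as `α` tends to `δ` (`Enumerates.exists_lt_level`). Since `χ` bounds the size of
the blocks, this holds for a whole block of `β`s at once. So if each `δ < λ` carries a colour `g δ`,
with every colour used stationarily often (Ulam's theorem, `Stationary.exists_partition`), it is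
enough to be able to recognise such a node `δ` in the walk from `β` to `α`, for all `β` in an upper
block and all `α` in a lower block simultaneously.

To that end each node also has a mark `h₁ < χ` and an index `h₂ < μ`, all combinations being
stationary, and its letter is the maximum of `h₂` and of its level. By Fodor's lemma one finds walks
`β → δ₂ → δ₁ → δ → α` with `h₂ δ₂ = i` and `h₁ δ₁ = θ`, where `δ` is fixed in advance, `i` ranges
over `χ` many values and `θ` over all of `χ`. The lower block is chosen below `δ` so that the letter
of `δ` exceeds all letters above it; then `θ` is chosen larger than all marks below `δ` and above
`δ₂`, so that the maximal mark `θ'` of the walk occurs between `δ₂` and `δ`. Fix injections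
`e ζ : ζ → χ` for `ζ < μ`, and let `ζ` be the largest letter of the walk, which occurs at or below
`δ`. As `χ` exceeds the size of the blocks, one of the values of `i` can be chosen last so that
`e ζ ξ > θ'` for all letters `ξ ≥ i` between `δ₂` and `δ`, while `e ζ ξ ≤ θ ≤ θ'` for the letter
`ξ < ζ` of `δ`. Hence `δ` is the first node after the maximal mark whose letter `ξ` exceeds all
letters up to that mark and which has `ξ = ζ` or `e ζ ξ ≤ θ'`; see `CutAt`, `cutAt_of` and
`walkColour_eq`. This proves `exists_strong_colouring`, which yields `Pr₁` for blocks of size `κ`.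

For finite lower blocks, the points of a block are told apart by the traces on a finite subset of
`μ` of distinct subsets of `μ`. There are `μ` such patterns, so one of them occurs `λ` many times,
and a colour can encode the pattern together with a finite function on it
(`exists_patterned_colouring`). This gives `Pr₀₀`.

For the space take `κ = ℵ₀` and the points `y_α` of the Cantor cube `2^λ` with `y_α β = c β α` for
`β < α` and `y_α β = 0` for `β ≥ α`, where `c` realises all patterns (and coordinates up to some
`Λ` are set to `1`). The space consists of the closures of the countable sets of such points, and
of the constant point `1`. A discrete set accumulating at `1` would contain points `x_ξ`, `ξ < λ`,
with `x_ξ` in the closure of countably many `y_α`, `α > ξ`, and isolated by finite conditions;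
Fodor's lemma makes these conditions agree below `ξ`, and the pattern property of `c` then gives
`σ < τ` such that `x_τ` satisfies the condition isolating `x_σ` (`not_accPt_top`).
-/

universe v

namespace StrongColouring

/-! ### Well-orders of successor type and stationary sets -/

/-- `X` behaves like the initial ordinal of the successor of the cardinal `m`: its initial segments
have size at most `m`, and its subsets of size at most `m` are strictly bounded. -/
structure SuccLike (X : Type v) [LinearOrder X] (m : Cardinal.{v}) : Prop where
  mk_Iio_le : ∀ x : X, #(Set.Iio x) ≤ m
  bdd : ∀ s : Set X, #s ≤ m → ∃ y, ∀ x ∈ s, x < y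

namespace SuccLike

variable {X : Type v} [LinearOrder X] {m : Cardinal.{v}}

theorem bdd_range (h : SuccLike X m) {ι : Type v} (f : ι → X) (hι : #ι ≤ m) :
    ∃ y, ∀ i, f i < y := by
  obtain ⟨y, hy⟩ := h.bdd (Set.range f) (mk_range_le.trans hι)
  exact ⟨y, fun i => hy _ ⟨i, rfl⟩⟩

theorem exists_gt (h : SuccLike X m) (hm : ℵ₀ ≤ m) (x : X) : ∃ y, x < y := by
  obtain ⟨y, hy⟩ := h.bdd {x} ((mk_le_aleph0).trans hm)
  exact ⟨y, hy x rfl⟩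

theorem nonempty (h : SuccLike X m) : Nonempty X := by
  obtain ⟨y, -⟩ := h.bdd ∅ (by simp)
  exact ⟨y⟩

theorem lt_mk (h : SuccLike X m) : m < #X := by
  by_contra hc
  obtain ⟨y, hy⟩ := h.bdd Set.univ (by rw [mk_univ]; exact not_lt.1 hc)
  exact lt_irrefl _ (hy y trivial)

theorem mk_Iic_le (h : SuccLike X m) (hm : ℵ₀ ≤ m) (x : X) : #(Set.Iic x) ≤ m := by
  obtain ⟨y, hy⟩ := h.exists_gt hm x
  exact (mk_le_mk_of_subset fun z hz => lt_of_le_of_lt hz hy).trans (h.mk_Iio_le y)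

theorem lt_mk_of_unbounded (h : SuccLike X m) {A : Set X} (hA : ∀ x, ∃ y ∈ A, x ≤ y) : m < #A := by
  by_contra hc
  obtain ⟨y, hy⟩ := h.bdd A (not_lt.1 hc)
  obtain ⟨z, hz, hyz⟩ := hA y
  exact absurd (hy z hz) (not_lt.2 hyz)

theorem mk_le_mk_of_unbounded (h : SuccLike X m) (hm : ℵ₀ ≤ m) {A : Set X}
    (hA : ∀ x, ∃ y ∈ A, x ≤ y) : #X ≤ #A := by
  have hcov : (⋃ y : A, Set.Iic y.1) = Set.univ := by
    ext x
    obtain ⟨y, hy, hxy⟩ := hA x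
    simp only [Set.mem_iUnion, Set.mem_univ, iff_true]
    exact ⟨⟨y, hy⟩, hxy⟩
  have h1 : #X ≤ #A * m := by
    calc #X = #(⋃ y : A, Set.Iic y.1) := by rw [hcov, mk_univ]
      _ ≤ Cardinal.sum fun y : A => #(Set.Iic y.1) := mk_iUnion_le_sum_mk
      _ ≤ Cardinal.sum fun _ : A => m := sum_le_sum _ _ fun y => h.mk_Iic_le hm _
      _ = _ := by simp
  exact h1.trans ((mul_le_max_of_aleph0_le_right hm).trans (max_le le_rfl (h.lt_mk_of_unbounded hA).le))

theorem mk_le_succ (h : SuccLike X m) (hm : ℵ₀ ≤ m) : #X ≤ Order.succ m := by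
  by_contra hc
  obtain ⟨A, hA⟩ := le_mk_iff_exists_set.1 (not_le.1 hc).le
  refine hc (hA ▸ h.mk_le_mk_of_unbounded hm fun x => ?_)
  by_contra hb
  push Not at hb
  have h1 : #A ≤ m := (mk_le_mk_of_subset fun y hy => hb y hy).trans (h.mk_Iio_le x)
  exact absurd (Order.lt_succ m) (not_lt.2 (hA ▸ h1))

/-- A partition of an unbounded set into few pieces has an unbounded piece. -/
theorem exists_unbounded_fiber (h : SuccLike X m) {Q : Type v} (hQ : #Q ≤ m) {A : Set X}
    (hA : ∀ x, ∃ y ∈ A, x ≤ y) (f : X → Q) : ∃ q, ∀ x, ∃ y ∈ A, f y = q ∧ x ≤ y := by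
  by_contra hc
  push Not at hc
  choose b hb using hc
  obtain ⟨z, hz⟩ := h.bdd_range b hQ
  obtain ⟨y, hyA, hy⟩ := hA z
  exact absurd (hz (f y)) (not_lt.2 (hy.trans (hb (f y) y hyA rfl).le))

end SuccLike

/-- A transfinite sequence of length `I` whose entries are related by `R` to all later ones exists
if every set of at most `m` elements has a common `R`-successor. -/
theorem exists_chain {I X : Type v} [LinearOrder I] [WellFoundedLT I] {m : Cardinal.{v}}
    (hI : ∀ i : I, #(Set.Iio i) ≤ m) (R : X → X → Prop)
    (h : ∀ T : Set X, #T ≤ m → ∃ x, ∀ t ∈ T, R t x) :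
    ∃ s : I → X, ∀ i j, i < j → R (s i) (s j) := by
  classical
  have h' : ∀ (j : I) (t : ∀ i, i < j → X), ∃ x, ∀ i hi, R (t i hi) x := by
    intro j t
    obtain ⟨x, hx⟩ := h (Set.range fun i : Set.Iio j => t i.1 i.2) (mk_range_le.trans (hI j))
    exact ⟨x, fun i hi => hx _ ⟨⟨i, hi⟩, rfl⟩⟩
  choose g hg using h'
  refine ⟨WellFounded.fix (wellFounded_lt (α := I)) g, fun i j hij => ?_⟩
  rw [WellFounded.fix_eq (wellFounded_lt (α := I)) g j]
  exact hg j (fun i _ => WellFounded.fix (wellFounded_lt (α := I)) g i) i hij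

/-- `S` is stationary, in the form used here: every `F : L → L` has a closure point in `S`. In a
`SuccLike` order these closure points generate the club filter; the least element of `L` is a
vacuous closure point, so this is used for sets of points that have predecessors. -/
def Stationary {L : Type v} [LinearOrder L] (S : Set L) : Prop :=
  ∀ F : L → L, ∃ δ ∈ S, ∀ x < δ, F x < δ

section Stationary

variable {L : Type v} [LinearOrder L] {m : Cardinal.{v}}

theorem Stationary.mono {S T : Set L} (h : Stationary S) (hST : S ⊆ T) : Stationary T := fun F => by
  obtain ⟨δ, hδ, hF⟩ := h F
  exact ⟨δ, hST hδ, hF⟩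

/-- The diagonal intersection of the closure conditions `F y` is again a closure condition. -/
theorem SuccLike.exists_diag (hL : SuccLike L m) (hm : ℵ₀ ≤ m) (F : L → L → L) :
    ∃ G : L → L, ∀ δ, (∀ x < δ, G x < δ) → ∀ y < δ, ∀ x < δ, F y x < δ := by
  have : ∀ z : L, ∃ w, ∀ p : Set.Iic z × Set.Iic z, F p.1 p.2 < w := fun z =>
    hL.bdd_range _ <| by
      refine (mul_def _ _).symm.le.trans ?_
      exact (mul_le_mul' (hL.mk_Iic_le hm z) (hL.mk_Iic_le hm z)).trans (mul_eq_self hm).le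
  choose G hG using this
  refine ⟨G, fun δ hδ y hy x hx => ?_⟩
  exact (hG (max y x) (⟨y, le_max_left _ _⟩, ⟨x, le_max_right _ _⟩)).trans (hδ _ (max_lt hy hx))

/-- Fodor's pressing-down lemma. -/
theorem Stationary.fodor (hL : SuccLike L m) (hm : ℵ₀ ≤ m) {S : Set L} (hS : Stationary S) (r : L → L)
    (hr : ∀ δ ∈ S, r δ < δ) : ∃ y, Stationary {δ ∈ S | r δ = y} := by
  by_contra hc
  simp only [Stationary, not_exists, not_forall, not_and] at hc
  choose F hF using hc
  obtain ⟨G, hG⟩ := hL.exists_diag hm F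
  obtain ⟨δ, hδ, hδG⟩ := hS G
  obtain ⟨x, hx, hxF⟩ := hF (r δ) δ ⟨hδ, rfl⟩
  exact hxF (hG δ hδG _ (hr δ hδ) x hx)

/-- A partition of a stationary set into few pieces has a stationary piece. -/
theorem Stationary.exists_fiber (hL : SuccLike L m) {S : Set L} (hS : Stationary S)
    {Q : Type v} (hQ : #Q ≤ m) (f : L → Q) : ∃ q, Stationary {δ ∈ S | f δ = q} := by
  by_contra hc
  simp only [Stationary, not_exists, not_forall, not_and] at hc
  choose F hF using hc
  have : ∀ z : L, ∃ w, ∀ q, F q z < w := fun z => hL.bdd_range _ hQ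
  choose G hG using this
  obtain ⟨δ, hδ, hδG⟩ := hS G
  obtain ⟨x, hx, hxF⟩ := hF (f δ) δ ⟨hδ, rfl⟩
  exact hxF ((hG x _).trans (hδG x hx))

theorem Stationary.inter_closed {S : Set L} (hS : Stationary S) (F : L → L) :
    Stationary {δ ∈ S | ∀ x < δ, F x < δ} := by
  intro G
  obtain ⟨δ, hδ, h⟩ := hS fun x => max (F x) (G x)
  exact ⟨δ, ⟨hδ, fun x hx => (le_max_left _ _).trans_lt (h x hx)⟩,
    fun x hx => (le_max_right _ _).trans_lt (h x hx)⟩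

theorem Stationary.exists_gt {S : Set L} (hS : Stationary S)
    (hpos : ∀ δ ∈ S, ∃ x, x < δ) (z : L) : ∃ δ ∈ S, z < δ := by
  obtain ⟨δ, hδ, h⟩ := hS fun _ => z
  obtain ⟨x, hx⟩ := hpos δ hδ
  exact ⟨δ, hδ, h x hx⟩

end Stationary

/-- The points of cofinality above `k`: all subsets of `Iio δ` of size at most `k` are bounded
strictly below `δ`. Taking the empty set and singletons, such a `δ` is a nonzero limit. -/
def HighCof (L : Type v) [LinearOrder L] (k : Cardinal.{v}) : Set L :=
  {δ | ∀ s : Set L, #s ≤ k → (∀ x ∈ s, x < δ) → ∃ y < δ, ∀ x ∈ s, x < y}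

section HighCof

variable {L : Type v} [LinearOrder L] {k : Cardinal.{v}}

theorem HighCof.exists_lt {δ : L} (h : δ ∈ HighCof L k) : ∃ x, x < δ := by
  obtain ⟨y, hy, -⟩ := h ∅ (by simp) (by simp)
  exact ⟨y, hy⟩

theorem HighCof.bdd_range {δ : L} (h : δ ∈ HighCof L k) {ι : Type v} (hι : #ι ≤ k) (f : ι → L)
    (hf : ∀ i, f i < δ) : ∃ y < δ, ∀ i, f i < y := by
  obtain ⟨y, hy, hy'⟩ := h (Set.range f) (mk_range_le.trans hι) (by rintro _ ⟨i, rfl⟩; exact hf i)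
  exact ⟨y, hy, fun i => hy' _ ⟨i, rfl⟩⟩

/-- A closure point of `F` of large cofinality is the supremum of an increasing sequence of length
`M` whose steps dominate `F`. -/
theorem stationary_highCof {M : Type v} [LinearOrder M] [WellFoundedLT M] [WellFoundedLT L]
    (hk : ℵ₀ ≤ k) (hM : SuccLike M k) (hL : SuccLike L #M) : Stationary (HighCof L k) := by
  intro F
  have hm : ℵ₀ ≤ #M := hk.trans hM.lt_mk.le
  have h1 : ∀ z : L, ∃ w, z < w ∧ ∀ x ≤ z, F x < w := by
    intro z
    obtain ⟨w, hw⟩ := hL.bdd_range (fun x : Set.Iic z => max (F x) z) (hL.mk_Iic_le hm z)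
    exact ⟨w, (le_max_right _ _).trans_lt (hw ⟨z, le_rfl⟩),
      fun x hx => (le_max_left _ _).trans_lt (hw ⟨x, hx⟩)⟩
  choose G hG1 hG2 using h1
  obtain ⟨s, hs⟩ := exists_chain (I := M) (X := L) hM.mk_Iio_le (fun t x => G t < x) fun T hT => by
    obtain ⟨y, hy⟩ := hL.bdd_range (fun t : T => G t) (hT.trans hM.lt_mk.le)
    exact ⟨y, fun t ht => hy ⟨t, ht⟩⟩
  obtain ⟨δ₀, hδ₀⟩ := hL.bdd_range s le_rfl
  obtain ⟨δ, hδ, hmin⟩ := WellFounded.has_min (wellFounded_lt (α := L)) {δ | ∀ i, s i < δ} ⟨δ₀, hδ₀⟩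
  have hex : ∀ x < δ, ∃ i, x ≤ s i := by
    intro x hx
    by_contra hc
    push Not at hc
    exact hmin x hc hx
  refine ⟨δ, ?_, fun x hx => ?_⟩
  · intro t ht htδ
    have := hM.nonempty
    choose! i hi using fun x (hx : x ∈ t) => hex x (htδ x hx)
    obtain ⟨j, hj⟩ := hM.bdd_range (fun x : t => i x) ht
    exact ⟨s j, hδ j, fun x hx =>
      ((hi x hx).trans_lt ((hG1 _).trans (hs _ _ (hj ⟨x, hx⟩))))⟩
  · obtain ⟨i, hi⟩ := hex x hx
    obtain ⟨j, hj⟩ := hM.exists_gt hk i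
    exact (hG2 _ x hi).trans ((hs i j hj).trans (hδ j))

end HighCof

/-- A family of injections of the initial segments of `X` into a set of size `m`. -/
theorem SuccLike.exists_injOn {X K : Type v} [LinearOrder X] (hX : SuccLike X #K) [Nonempty K] :
    ∃ e : X → X → K, ∀ x, Set.InjOn (e x) (Set.Iio x) := by
  have : ∀ x : X, ∃ f : X → K, Set.InjOn f (Set.Iio x) := by
    intro x
    obtain ⟨g⟩ := (Cardinal.le_def (Set.Iio x) K).1 (hX.mk_Iio_le x)
    classical
    refine ⟨fun y => if h : y < x then g ⟨y, h⟩ else Classical.arbitrary K, ?_⟩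
    intro y hy z hz hyz
    simp only [Set.mem_Iio] at hy hz
    simp only [hy, hz, dif_pos] at hyz
    exact congrArg Subtype.val (g.injective hyz)
  choose e he using this
  exact ⟨e, he⟩

/-- Ulam's theorem: a stationary set splits into as many stationary sets as `L` has elements. With
`e δ : Iio δ → M` injective, the sets `{δ | y < δ ∧ e δ y = ν}` form an Ulam matrix; a single row
`ν` contains stationary entries for `#L` many `y`. -/
theorem Stationary.exists_partition {M L Q : Type v} [LinearOrder L] [Nonempty M]
    (hM : ℵ₀ ≤ #M) (hL : SuccLike L #M) {S : Set L} (hS : Stationary S) (hpos : ∀ δ ∈ S, ∃ x, x < δ)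
    [Nonempty Q] (hQ : #Q ≤ #L) :
    ∃ f : L → Q, ∀ q, Stationary {δ ∈ S | f δ = q} := by
  classical
  obtain ⟨e, he⟩ := hL.exists_injOn
  have h1 : ∀ y : L, ∃ ν : M, Stationary {δ ∈ S | y < δ ∧ e δ y = ν} := by
    intro y
    have h2 : Stationary {δ ∈ S | y < δ} := by
      refine (hS.inter_closed fun _ => y).mono ?_
      rintro δ ⟨hδ, h⟩
      obtain ⟨x, hx⟩ := hpos δ hδ
      exact ⟨hδ, h x hx⟩
    obtain ⟨ν, hν⟩ := h2.exists_fiber hL le_rfl fun δ => e δ y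
    refine ⟨ν, hν.mono ?_⟩
    rintro δ ⟨⟨h, h'⟩, h''⟩
    exact ⟨h, h', h''⟩
  choose ν hν using h1
  obtain ⟨q, hq⟩ := hL.exists_unbounded_fiber (Q := M) le_rfl (A := Set.univ)
    (fun x => ⟨x, trivial, le_rfl⟩) ν
  have hA : #Q ≤ #{y | ν y = q} := hQ.trans <| hL.mk_le_mk_of_unbounded hM fun x => by
    obtain ⟨y, -, h, h'⟩ := hq x
    exact ⟨y, h, h'⟩
  obtain ⟨g⟩ := (Cardinal.le_def _ _).1 hA
  refine ⟨fun δ => if h : ∃ p : Q, (g p).1 < δ ∧ e δ (g p).1 = q then h.choose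
    else Classical.arbitrary Q, fun p => ?_⟩
  have h5 := hν (g p).1
  rw [show ν (g p).1 = q from (g p).2] at h5
  refine h5.mono ?_
  rintro δ ⟨hδ, hlt, hed⟩
  refine ⟨hδ, ?_⟩
  have hex : ∃ p : Q, (g p).1 < δ ∧ e δ (g p).1 = q := ⟨p, hlt, hed⟩
  have h6 := hex.choose_spec
  refine (dif_pos hex).trans ?_
  exact g.injective (Subtype.ext (he δ h6.1 hlt (h6.2.trans hed.symm)))

/-! ### Walks and the decoding of a position -/

section Walks

variable {L M : Type v} [LinearOrder L] [LinearOrder M] [WellFoundedLT M] [Nonempty M]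

/-- `f x` maps `M` onto the initial segment below `x`, for every `x` that is not the least element
(nothing is required of the least element). -/
structure Enumerates (f : L → M → L) : Prop where
  lt : ∀ x y, y < x → ∀ ν, f x ν < x
  surj : ∀ x y, y < x → ∃ ν, f x ν = y

omit [LinearOrder M] [WellFoundedLT M] [Nonempty M] in
theorem SuccLike.exists_enumerates (hL : SuccLike L #M) : ∃ f : L → M → L, Enumerates f := by
  have : ∀ x : L, ∃ g : M → L, (∀ y, y < x → ∀ ν, g ν < x) ∧ ∀ y, y < x → ∃ ν, g ν = y := by
    intro x
    by_cases hx : ∃ y, y < x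
    · obtain ⟨y, hy⟩ := hx
      obtain ⟨i⟩ := (Cardinal.le_def (Set.Iio x) M).1 (hL.mk_Iio_le x)
      have : Nonempty (Set.Iio x) := ⟨⟨y, hy⟩⟩
      refine ⟨fun ν => (Function.invFun i ν).1, fun _ _ ν => (Function.invFun i ν).2, fun z hz => ?_⟩
      exact ⟨i ⟨z, hz⟩, congrArg Subtype.val (Function.leftInverse_invFun i.injective ⟨z, hz⟩)⟩
    · exact ⟨fun _ => x, fun y hy => absurd ⟨y, hy⟩ hx, fun y hy => absurd ⟨y, hy⟩ hx⟩
  choose f hf using this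
  exact ⟨f, fun x => (hf x).1, fun x => (hf x).2⟩

open Classical in
/-- The least index of an entry of `f x` that is at least `α`; it is used only for `α < x`, where
there is one. -/
noncomputable def level (f : L → M → L) (x α : L) : M :=
  if h : ∃ ν, α ≤ f x ν then (wellFounded_lt (α := M)).min {ν | α ≤ f x ν} h
  else Classical.arbitrary M

theorem level_eq {f : L → M → L} {x α : L} {ν : M} (h1 : α ≤ f x ν) (h2 : ∀ ν' < ν, f x ν' < α) :
    level f x α = ν := by
  have hex : ∃ ν, α ≤ f x ν := ⟨ν, h1⟩
  rw [level, dif_pos hex]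
  set ν₀ := (wellFounded_lt (α := M)).min {ν | α ≤ f x ν} hex
  have h3 : α ≤ f x ν₀ := (wellFounded_lt (α := M)).min_mem {ν | α ≤ f x ν} hex
  rcases lt_trichotomy ν₀ ν with h | h | h
  · exact absurd (h2 _ h) (not_lt.2 h3)
  · exact h
  · exact absurd h ((wellFounded_lt (α := M)).not_lt_min {ν | α ≤ f x ν} h1)

theorem Enumerates.level_spec {f : L → M → L} (hf : Enumerates f) {x α : L} (h : α < x) :
    α ≤ f x (level f x α) ∧ ∀ ν < level f x α, f x ν < α := by
  have hex : ∃ ν, α ≤ f x ν := (hf.surj x α h).imp fun _ h => h.ge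
  rw [level, dif_pos hex]
  exact ⟨(wellFounded_lt (α := M)).min_mem {ν | α ≤ f x ν} hex, fun ν hν =>
    not_le.1 fun hc => (wellFounded_lt (α := M)).not_lt_min {ν | α ≤ f x ν} hc hν⟩

open Classical in
/-- One step of the walk towards `α`, from `x > α` to the first entry of `f x` that is at least
`α`; points `x ≤ α` are left fixed. -/
noncomputable def walkStep (f : L → M → L) (α x : L) : L :=
  if α < x then f x (level f x α) else x

/-- The `n`-th node of the walk from `β` down to `α`; once the walk has reached `α` it stays
there. -/
noncomputable def walk (f : L → M → L) (β α : L) (n : ℕ) : L := (walkStep f α)^[n] β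

@[simp] theorem walk_zero (f : L → M → L) (β α : L) : walk f β α 0 = β := rfl

theorem walk_succ (f : L → M → L) (β α : L) (n : ℕ) :
    walk f β α (n + 1) = walkStep f α (walk f β α n) := Function.iterate_succ_apply' _ _ _

theorem walk_add (f : L → M → L) (β α : L) (m n : ℕ) :
    walk f β α (m + n) = walk f (walk f β α m) α n := by
  rw [walk, add_comm, Function.iterate_add_apply]; rfl

/-- The number of steps of the walk from `β` to `α`. -/
noncomputable def walkLen (f : L → M → L) (β α : L) : ℕ := sInf {n | walk f β α n = α}

theorem walkLen_eq {f : L → M → L} {α β : L} {n : ℕ} (h1 : walk f β α n = α)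
    (h2 : ∀ k < n, α < walk f β α k) :
    walkLen f β α = n :=
  le_antisymm (Nat.sInf_le h1) (le_csInf ⟨n, h1⟩ fun k hk => not_lt.1 fun hc => (h2 k hc).ne' hk)

/-- The walk from `β` to any point of `[Λ, δ)` passes through `δ`, and agrees with the walk
from `β` to `δ` up to there, including the levels. -/
def Passes (f : L → M → L) (β δ Λ : L) : Prop :=
  ∀ α, Λ ≤ α → α < δ → (∀ k ≤ walkLen f β δ, walk f β α k = walk f β δ k) ∧
    ∀ k < walkLen f β δ, level f (walk f β δ k) α = level f (walk f β δ k) δ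

theorem Passes.mono {f : L → M → L} {β δ Λ Λ' : L} (h : Passes f β δ Λ)
    (hΛ : Λ ≤ Λ') : Passes f β δ Λ' :=
  fun α hα => h α (hΛ.trans hα)

variable {f : L → M → L} (hf : Enumerates f)
include hf

theorem Enumerates.walkStep_lt {α x : L} (h : α < x) : walkStep f α x < x := by
  rw [walkStep, if_pos h]; exact hf.lt x α h _

theorem Enumerates.le_walkStep {α x : L} (h : α ≤ x) : α ≤ walkStep f α x := by
  rw [walkStep]
  split_ifs with h'
  · exact (hf.level_spec h').1
  · exact h

theorem Enumerates.le_walk {α β : L} (h : α ≤ β) (n : ℕ) : α ≤ walk f β α n := by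
  induction n with
  | zero => exact h
  | succ n ih => rw [walk_succ]; exact hf.le_walkStep ih

variable [WellFoundedLT L]

theorem Enumerates.exists_walk_eq {α β : L} (h : α ≤ β) : ∃ n, walk f β α n = α := by
  induction β using WellFoundedLT.induction with
  | ind β ih =>
    rcases h.eq_or_lt with rfl | h
    · exact ⟨0, rfl⟩
    · obtain ⟨n, hn⟩ := ih (walkStep f α β) (hf.walkStep_lt h) (hf.le_walkStep h.le)
      exact ⟨n + 1, by rw [add_comm, walk_add]; exact hn⟩

theorem Enumerates.walk_walkLen {α β : L} (h : α ≤ β) : walk f β α (walkLen f β α) = α :=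
  Nat.sInf_mem (s := {n | walk f β α n = α}) (hf.exists_walk_eq h)

omit [WellFoundedLT L] in
theorem Enumerates.lt_walk {α β : L} (h : α ≤ β) {k : ℕ} (hk : k < walkLen f β α) :
    α < walk f β α k :=
  (hf.le_walk h k).lt_of_ne fun hc => Nat.notMem_of_lt_sInf hk hc.symm

theorem Passes.walk_add {β δ Λ α : L} (h : Passes f β δ Λ) (hβ : δ ≤ β) (h1 : Λ ≤ α) (h2 : α < δ)
    (n : ℕ) : walk f β α (walkLen f β δ + n) = walk f δ α n := by
  rw [StrongColouring.walk_add, (h α h1 h2).1 _ le_rfl, hf.walk_walkLen hβ]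

theorem Passes.walkLen_eq {β δ Λ α : L} (h : Passes f β δ Λ) (hβ : δ ≤ β) (h1 : Λ ≤ α)
    (h2 : α < δ) : walkLen f β α = walkLen f β δ + walkLen f δ α := by
  apply StrongColouring.walkLen_eq
  · rw [h.walk_add hf hβ h1 h2, hf.walk_walkLen h2.le]
  · intro k hk
    rcases lt_or_ge k (walkLen f β δ) with hlt | hge
    · rw [(h α h1 h2).1 _ hlt.le]
      exact h2.trans (hf.lt_walk hβ hlt)
    · obtain ⟨n, rfl⟩ := Nat.exists_eq_add_of_le hge
      rw [h.walk_add hf hβ h1 h2]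
      exact hf.lt_walk h2.le (by omega)

variable {k : Cardinal.{v}}

omit [WellFoundedLT L] in
/-- The entries of `f x` before the first one that is at least `δ` are too few to be cofinal in
`δ`, so the level of `x` is constant on a final segment of `Iic δ`. -/
theorem Enumerates.level_stable (hM : SuccLike M k) {δ x : L} (hδ : δ ∈ HighCof L k) (hx : δ < x) :
    ∃ Λ < δ, ∀ α, Λ ≤ α → α ≤ δ → level f x α = level f x δ := by
  obtain ⟨h1, h2⟩ := hf.level_spec hx
  obtain ⟨Λ, hΛ, h⟩ := HighCof.bdd_range hδ (hM.mk_Iio_le (level f x δ)) (fun ν => f x ν.1)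
    (fun ν => h2 _ ν.2)
  exact ⟨Λ, hΛ, fun α h3 h4 => level_eq (h4.trans h1) fun ν hν => (h ⟨ν, hν⟩).trans_le h3⟩

omit [WellFoundedLT L] in
theorem Enumerates.exists_passes (hk : ℵ₀ ≤ k) (hM : SuccLike M k) {δ β : L}
    (hδ : δ ∈ HighCof L k) (hβ : δ < β) : ∃ Λ < δ, Passes f β δ Λ := by
  have : Nonempty L := ⟨δ⟩
  choose! Λ hΛ h using fun j (hj : j < walkLen f β δ) =>
    hf.level_stable hM hδ (hf.lt_walk hβ.le hj)
  obtain ⟨y, hy, hy'⟩ := hδ (Λ '' {j | j < walkLen f β δ})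
    ((((Set.to_countable _).image Λ).le_aleph0).trans hk) (by rintro _ ⟨j, hj, rfl⟩; exact hΛ j hj)
  have h3 : ∀ j < walkLen f β δ, Λ j ≤ y := fun j hj => (hy' _ ⟨j, hj, rfl⟩).le
  refine ⟨y, hy, fun α h1 h2 => ⟨fun j => ?_, fun j hj => h j hj α ((h3 j hj).trans h1) h2.le⟩⟩
  induction j with
  | zero => intro; rfl
  | succ j ih =>
    intro hj
    have hj' : j < walkLen f β δ := hj
    have h4 := hf.lt_walk hβ.le hj'
    rw [walk_succ, walk_succ, ih hj'.le, walkStep, walkStep, if_pos h4, if_pos (h2.trans h4),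
      h j hj' α ((h3 j hj').trans h1) h2.le]

omit [WellFoundedLT L] in
/-- The bound of `Enumerates.exists_passes` can be chosen uniformly for a small set of starting
points. -/
theorem Enumerates.exists_passes_set (hk : ℵ₀ ≤ k) (hM : SuccLike M k) {δ : L}
    (hδ : δ ∈ HighCof L k) {ι : Type v} (hι : #ι ≤ k) (b : ι → L) (hb : ∀ i, δ < b i) :
    ∃ Λ < δ, ∀ i, Passes f (b i) δ Λ := by
  choose Λ hΛ h using fun i => hf.exists_passes hk hM hδ (hb i)
  obtain ⟨y, hy, hy'⟩ := HighCof.bdd_range hδ hι Λ hΛ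
  exact ⟨y, hy, fun i => (h i).mono (hy' i).le⟩

omit [WellFoundedLT L] in
/-- The level of `δ` over `α` is large when `α` is close to `δ`. -/
theorem Enumerates.exists_lt_level (hk : ℵ₀ ≤ k) (hM : SuccLike M k) {δ : L}
    (hδ : δ ∈ HighCof L k) (j : M) : ∃ Λ < δ, ∀ α, Λ ≤ α → α < δ → j < level f δ α := by
  obtain ⟨x, hx⟩ := HighCof.exists_lt hδ
  obtain ⟨Λ, hΛ, h⟩ := HighCof.bdd_range hδ (hM.mk_Iic_le hk j) (fun ν => f δ ν.1)
    (fun ν => hf.lt δ x hx _)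
  refine ⟨Λ, hΛ, fun α h1 h2 => not_le.1 fun hc => ?_⟩
  exact absurd ((hf.level_spec h2).1.trans_lt (h ⟨_, hc⟩)) (not_lt.2 h1)

end Walks

section Decoding

variable {K M : Type v} [LinearOrder K] [LinearOrder M]

/-- In a sequence of length `N` with marks `H` and letters `w`, a position `r` after `p` is a
candidate (relative to `p` and `ζ`) if its letter exceeds all letters up to `p` and either equals
`ζ` or has an `e ζ`-value at most the mark of `p`. -/
def Candidate (e : M → M → K) (N : ℕ) (H : ℕ → K) (w : ℕ → M) (p : ℕ) (ζ : M) (r : ℕ) : Prop :=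
  p < r ∧ r < N ∧ (∀ k ≤ p, w k < w r) ∧ (w r = ζ ∨ e ζ (w r) ≤ H p)

/-- The position `q` selected by the decoding: `p` is the first position of the largest mark, `ζ`
is the largest letter, and `q` is the first candidate. -/
def CutAt (e : M → M → K) (N : ℕ) (H : ℕ → K) (w : ℕ → M) (q : ℕ) : Prop :=
  ∃ p ζ, (p < N ∧ (∀ k < N, H k ≤ H p) ∧ ∀ k < p, H k < H p) ∧
    ((∃ k < N, w k = ζ) ∧ ∀ k < N, w k ≤ ζ) ∧
    Candidate e N H w p ζ q ∧ ∀ r < q, ¬ Candidate e N H w p ζ r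

variable {e : M → M → K} {N : ℕ} {H : ℕ → K} {w : ℕ → M}

theorem CutAt.unique {q q' : ℕ} (h : CutAt e N H w q) (h' : CutAt e N H w q') : q = q' := by
  obtain ⟨p, ζ, ⟨hp, hpm, hpl⟩, ⟨⟨k, hk, hkζ⟩, hζ⟩, hq, hql⟩ := h
  obtain ⟨p', ζ', ⟨hp', hpm', hpl'⟩, ⟨⟨k', hk', hkζ'⟩, hζ'⟩, hq', hql'⟩ := h'
  obtain rfl : p = p' := by
    rcases lt_trichotomy p p' with hlt | rfl | hlt
    · exact absurd (hpl' p hlt) (not_lt.2 (hpm p' hp'))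
    · rfl
    · exact absurd (hpl p' hlt) (not_lt.2 (hpm' p hp))
  obtain rfl : ζ = ζ' := le_antisymm (hkζ ▸ hζ' k hk) (hkζ' ▸ hζ k' hk')
  rcases lt_trichotomy q q' with hlt | rfl | hlt
  · exact absurd hq (hql' q hlt)
  · rfl
  · exact absurd hq' (hql q' hlt)

/-- The decoding finds the position `n` in the following situation. Marks from `n` on and before
`n₁` are below `θ`, some mark before `n` is at least `θ`, and all marks before `n` are at most `τ`:
so the largest mark lies between `n₁` and `n`. The letter of `n` exceeds the earlier ones. Letters
`ξ ≥ i` between `n₁` and `n` have `e ζ ξ > τ`, and hence are not candidates, where `ζ` is the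
largest letter from `n` on. -/
theorem cutAt_of {n n₁ : ℕ} {θ τ : K} {i ζ : M} (hn : n < N)
    (hτ : ∀ k < n, H k ≤ τ) (hθ : ∃ k < n, θ ≤ H k) (hθ₁ : ∀ k < n₁, H k < θ)
    (hθn : ∀ k, n ≤ k → k < N → H k < θ) (hi : i ≤ w n₁) (hw : ∀ k < n, w k < w n)
    (hζ : ∃ k, n ≤ k ∧ k < N ∧ w k = ζ) (hζm : ∀ k, n ≤ k → k < N → w k ≤ ζ)
    (hX : ∀ k, n₁ ≤ k → k < n → i ≤ w k → τ < e ζ (w k)) (hnζ : w n = ζ ∨ e ζ (w n) ≤ θ) :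
    CutAt e N H w n := by
  obtain ⟨p, ⟨hpN, hpm⟩, hpl⟩ : ∃ p, (p < N ∧ ∀ k < N, H k ≤ H p) ∧
      ∀ k < p, ¬ (k < N ∧ ∀ k' < N, H k' ≤ H k) := by
    have hex : ∃ p, p < N ∧ ∀ k < N, H k ≤ H p := by
      obtain ⟨p, hp, h⟩ := (Finset.range N).exists_max_image H ⟨n, by simpa using hn⟩
      exact ⟨p, by simpa using hp, fun k hk => h k (by simpa using hk)⟩
    classical
    exact ⟨Nat.find hex, Nat.find_spec hex, fun k hk => Nat.find_min hex hk⟩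
  obtain ⟨k₀, hk₀, hk₀θ⟩ := hθ
  have hpθ : θ ≤ H p := hk₀θ.trans (hpm k₀ (hk₀.trans hn))
  have hpn : p < n := not_le.1 fun hc => absurd (hθn p hc hpN) (not_lt.2 hpθ)
  have hn₁p : n₁ ≤ p := not_lt.1 fun hc => absurd (hθ₁ p hc) (not_lt.2 hpθ)
  have hnle : w n ≤ ζ := hζm n le_rfl hn
  refine ⟨p, ζ, ⟨hpN, hpm, fun k hk => ?_⟩, ⟨?_, fun k hk => ?_⟩, ⟨hpn, hn, ?_, ?_⟩, ?_⟩
  · by_contra hc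
    exact hpl k hk ⟨hk.trans hpN, fun k' hk' => (hpm k' hk').trans (not_lt.1 hc)⟩
  · obtain ⟨k, -, h2, h3⟩ := hζ
    exact ⟨k, h2, h3⟩
  · rcases lt_or_ge k n with h | h
    · exact (hw k h).le.trans hnle
    · exact hζm k h hk
  · exact fun k hk => hw k (hk.trans_lt hpn)
  · exact hnζ.imp id fun h => h.trans hpθ
  · rintro r hr ⟨hpr, -, hwr, h⟩
    have h1 := hX r (hn₁p.trans hpr.le) hr (hi.trans (hwr n₁ hn₁p).le)
    rcases h with h | h
    · exact absurd (h ▸ hw r hr) (not_lt.2 hnle)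
    · exact absurd h1 (not_lt.2 (h.trans (hτ p hpn)))

end Decoding

/-! ### The colouring for `Pr₁` -/

section Colouring

variable {K L M : Type v} [LinearOrder K] [LinearOrder L] [LinearOrder M] [WellFoundedLT M]
  [Nonempty M]

/-- The letter of the node `x` in a walk towards `α`. The static part `h₂ x` can be prescribed on a
stationary set; the level can be made large by moving `α` closer to `x`. -/
noncomputable def letter (f : L → M → L) (h₂ : L → M) (α x : L) : M := max (h₂ x) (level f x α)

open Classical in
/-- The colour of the pair `α < β` is the value of `g` at the node of the walk from `β` to `α` that
is selected by the decoding, if there is one (the default value `β` plays no role). -/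
noncomputable def walkColour (f : L → M → L) (e : M → M → K) (h₁ : L → K) (h₂ : L → M) (g : L → L)
    (α β : L) : L :=
  if h : ∃ q, CutAt e (walkLen f β α) (fun k => h₁ (walk f β α k))
    (fun k => letter f h₂ α (walk f β α k)) q then g (walk f β α h.choose) else β

variable [WellFoundedLT L]

/-- The colour of `α < β` is `g δ` if the walk from `β` to `α` passes through `δ₂`, `δ₁` and `δ`,
where `δ₂` has the index `i` and `δ₁` the mark `θ`, and the marks and letters along the way are
bounded as in `cutAt_of`. -/
theorem walkColour_eq {f : L → M → L} {e : M → M → K} {h₁ : L → K} {h₂ : L → M} {g : L → L}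
    (hf : Enumerates f) {α β δ δ₁ δ₂ Λ Λ₁ Λ₂ : L} {i ζ : M} {θ τ : K}
    (hα : α < δ) (hδ : δ < δ₁) (hδ₁ : δ₁ < δ₂) (hδ₂ : δ₂ < β)
    (hp₂ : Passes f β δ₂ Λ₂) (hΛ₂ : Λ₂ ≤ δ) (hp₁ : Passes f δ₂ δ₁ Λ₁) (hΛ₁ : Λ₁ ≤ δ)
    (hp : Passes f β δ Λ) (hΛ : Λ ≤ α) (hi : h₂ δ₂ = i) (hθ : h₁ δ₁ = θ)
    (hτ : ∀ k, h₁ (walk f β δ k) ≤ τ) (hθ₂ : ∀ k, h₁ (walk f β δ₂ k) < θ)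
    (hθα : ∀ k, h₁ (walk f δ α k) < θ)
    (hw : ∀ k, letter f h₂ δ (walk f β δ k) < level f δ α)
    (hζ : ∃ k < walkLen f δ α, letter f h₂ α (walk f δ α k) = ζ)
    (hζm : ∀ k < walkLen f δ α, letter f h₂ α (walk f δ α k) ≤ ζ)
    (hX : ∀ k, i ≤ letter f h₂ δ (walk f δ₂ δ k) → τ < e ζ (letter f h₂ δ (walk f δ₂ δ k)))
    (he : e ζ (letter f h₂ α δ) ≤ θ) :
    walkColour f e h₁ h₂ g α β = g δ := by
  have hβδ : δ < β := hδ.trans (hδ₁.trans hδ₂)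
  have hδδ₂ : δ < δ₂ := hδ.trans hδ₁
  set n := walkLen f β δ with hn
  have hN : walkLen f β α = n + walkLen f δ α := hp.walkLen_eq hf hβδ.le hΛ hα
  have hpos : 0 < walkLen f δ α := by
    by_contra hc
    have h0 : walkLen f δ α = 0 := by omega
    have := hf.walk_walkLen hα.le
    rw [h0, walk_zero] at this
    exact hα.ne' this
  have hn' : n = walkLen f β δ₂ + walkLen f δ₂ δ := hp₂.walkLen_eq hf hδ₂.le hΛ₂ hδδ₂
  have hn'' : walkLen f δ₂ δ = walkLen f δ₂ δ₁ + walkLen f δ₁ δ := hp₁.walkLen_eq hf hδ₁.le hΛ₁ hδ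
  have hδ₁pos : 0 < walkLen f δ₁ δ := by
    by_contra hc
    have h0 : walkLen f δ₁ δ = 0 := by omega
    have := hf.walk_walkLen hδ.le
    rw [h0, walk_zero] at this
    exact hδ.ne' this
  have hlow : ∀ k < n, walk f β α k = walk f β δ k := fun k hk => (hp α hΛ hα).1 k hk.le
  have hlow' : ∀ k < n, letter f h₂ α (walk f β α k) = letter f h₂ δ (walk f β δ k) := by
    intro k hk
    rw [hlow k hk, letter, letter, (hp α hΛ hα).2 k hk]
  have hhigh : ∀ k, walk f β α (n + k) = walk f δ α k := hp.walk_add hf hβδ.le hΛ hα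
  have hat : walk f β α n = δ := hhigh 0
  have hmid : ∀ k, walk f β δ (walkLen f β δ₂ + k) = walk f δ₂ δ k :=
    hp₂.walk_add hf hδ₂.le hΛ₂ hδδ₂
  have hmain : CutAt e (walkLen f β α) (fun k => h₁ (walk f β α k))
      (fun k => letter f h₂ α (walk f β α k)) n := by
    refine cutAt_of (n₁ := walkLen f β δ₂) (θ := θ) (τ := τ) (i := i) (ζ := ζ) (by omega)
      (fun k hk => ?_) ⟨walkLen f β δ₂ + walkLen f δ₂ δ₁, by omega, ?_⟩ (fun k hk => ?_)
      (fun k hk hk' => ?_) ?_ (fun k hk => ?_) ?_ (fun k hk hk' => ?_) (fun k hk hk' hik => ?_) ?_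
    · simp only [hlow k hk]; exact hτ k
    · have h1 : walk f β δ (walkLen f β δ₂ + walkLen f δ₂ δ₁) = δ₁ := by
        rw [hmid, show walkLen f δ₂ δ₁ = walkLen f δ₂ δ₁ + 0 from rfl,
          hp₁.walk_add hf hδ₁.le hΛ₁ hδ, walk_zero]
      rw [hlow _ (by omega), h1, hθ]
    · have h2 : walk f β δ k = walk f β δ₂ k := (hp₂ δ hΛ₂ hδδ₂).1 k hk.le
      rw [hlow k (by omega), h2]
      exact hθ₂ k
    · obtain ⟨k, rfl⟩ := Nat.exists_eq_add_of_le hk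
      simp only [hhigh]
      exact hθα k
    · have h3 : walk f β δ (walkLen f β δ₂) = δ₂ := hmid 0
      rw [hlow _ (by omega), h3, letter, hi]
      exact le_max_left _ _
    · simp only [hlow' k hk, hat]
      exact (hw k).trans_le (le_max_right _ _)
    · obtain ⟨k, hk, h⟩ := hζ
      exact ⟨n + k, by omega, by omega, by simpa only [hhigh] using h⟩
    · obtain ⟨k, rfl⟩ := Nat.exists_eq_add_of_le hk
      simp only [hhigh]
      exact hζm k (by omega)
    · obtain ⟨k, rfl⟩ := Nat.exists_eq_add_of_le hk
      simp only [hlow' _ hk', hmid] at hik ⊢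
      exact hX k hik
    · right
      simp only [hat]
      exact he
  have hex : ∃ q, CutAt e (walkLen f β α) (fun k => h₁ (walk f β α k))
    (fun k => letter f h₂ α (walk f β α k)) q := ⟨n, hmain⟩
  rw [walkColour, dif_pos hex, hex.choose_spec.unique hmain, hat]

theorem SuccLike.bdd_range_nat {X : Type v} [LinearOrder X] {m : Cardinal.{v}} (hX : SuccLike X m)
    (hm : ℵ₀ ≤ m) {ι : Type v} (hι : #ι ≤ m) (φ : ι → ℕ → X) : ∃ y, ∀ i n, φ i n < y := by
  choose b hb using fun i => hX.bdd (Set.range (φ i)) ((Set.countable_range _).le_aleph0.trans hm)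
  obtain ⟨y, hy⟩ := hX.bdd_range b hι
  exact ⟨y, fun i n => (hb i _ ⟨n, rfl⟩).trans (hy i)⟩

theorem SuccLike.bdd_range_prod {X : Type v} [LinearOrder X] {m : Cardinal.{v}} (hX : SuccLike X m)
    {ι ι' : Type v} (hι : #ι ≤ m) (hι' : #ι' ≤ m) (φ : ι → ι' → X) : ∃ y, ∀ i j, φ i j < y := by
  choose b hb using fun i => hX.bdd_range (φ i) hι'
  obtain ⟨y, hy⟩ := hX.bdd_range b hι
  exact ⟨y, fun i j => (hb i j).trans (hy i)⟩

variable [WellFoundedLT K]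

omit [Nonempty M] in
/-- The strong colouring, for blocks `A s` and `B t` of size at most `κ` of which there are some
beyond every point. The separating point `δ` in the conclusion records the order of the blocks. -/
theorem exists_strong_colouring {κ : Cardinal.{v}} (hκ : ℵ₀ ≤ κ) (hK : SuccLike K κ)
    (hM : SuccLike M #K) (hL : SuccLike L #M) :
    ∃ c : L → L → L, ∀ A B : L → Set L, (∀ s, #(A s) ≤ κ) → (∀ t, #(B t) ≤ κ) →
      (∀ z, ∃ s, ∀ x ∈ A s, z < x) → (∀ z, ∃ t, ∀ x ∈ B t, z < x) → ∀ γ, ∃ s t δ,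
        (∀ α ∈ A s, α < δ) ∧ (∀ β ∈ B t, δ < β) ∧ ∀ α ∈ A s, ∀ β ∈ B t, c α β = γ := by
  have hκK : κ ≤ #K := hK.lt_mk.le
  have hK0 : ℵ₀ ≤ #K := hκ.trans hκK
  have hKM : #K ≤ #M := hM.lt_mk.le
  have hM0 : ℵ₀ ≤ #M := hK0.trans hKM
  have hML : #M ≤ #L := hL.lt_mk.le
  have hL0 : ℵ₀ ≤ #L := hM0.trans hML
  have := hK.nonempty
  have := hM.nonempty
  have := hL.nonempty
  set S := HighCof L #K with hS
  have hSstat : Stationary S := stationary_highCof hK0 hM hL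
  have hSpos : ∀ δ ∈ S, ∃ x, x < δ := fun δ hδ => HighCof.exists_lt hδ
  obtain ⟨G, hG⟩ := hSstat.exists_partition (Q := K × M × L) hM0 hL hSpos <| by
    rw [← mul_def, ← mul_def]
    exact (mul_le_mul' (hKM.trans hML) ((mul_le_mul' hML le_rfl).trans (mul_eq_self hL0).le)).trans
      (mul_eq_self hL0).le
  set h₁ : L → K := fun x => (G x).1 with hh₁
  set h₂ : L → M := fun x => (G x).2.1 with hh₂
  set g : L → L := fun x => (G x).2.2 with hg
  have hG₁ : ∀ θ, Stationary {δ ∈ S | h₁ δ = θ} := fun θ =>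
    (hG ⟨θ, Classical.arbitrary M, Classical.arbitrary L⟩).mono fun δ hδ => ⟨hδ.1, by simp [hh₁, hδ.2]⟩
  have hG₂ : ∀ i, Stationary {δ ∈ S | h₂ δ = i} := fun i =>
    (hG ⟨Classical.arbitrary K, i, Classical.arbitrary L⟩).mono fun δ hδ => ⟨hδ.1, by simp [hh₂, hδ.2]⟩
  have hGg : ∀ γ, Stationary {δ ∈ S | g δ = γ} := fun γ =>
    (hG ⟨Classical.arbitrary K, Classical.arbitrary M, γ⟩).mono fun δ hδ => ⟨hδ.1, by simp [hg, hδ.2]⟩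
  obtain ⟨f, hf⟩ := hL.exists_enumerates (M := M)
  obtain ⟨e, he⟩ := hM.exists_injOn
  refine ⟨walkColour f e h₁ h₂ g, fun A B hA hB hAu hBu γ => ?_⟩
  choose sA hsA using hAu
  choose tB htB using hBu
  -- Fodor's lemma for nodes `δ` with index `i` and the block `B (tB δ)` above `δ`.
  have step₁ : ∀ i : M, ∃ (Λ : L) (t : K), Stationary {δ | δ ∈ S ∧ h₂ δ = i ∧
      (∀ β ∈ B (tB δ), Passes f β δ Λ) ∧ ∀ β ∈ B (tB δ), ∀ k, h₁ (walk f β δ k) < t} := by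
    intro i
    choose! r hr hr' using fun δ (hδ : δ ∈ S) => hf.exists_passes_set hK0 hM hδ
      ((hB (tB δ)).trans hκK) (fun β : B (tB δ) => β.1) (fun β => htB δ _ β.2)
    obtain ⟨Λ, hΛ⟩ := (hG₂ i).fodor hL hM0 r fun δ hδ => hr δ hδ.1
    choose t ht using fun δ => hK.bdd_range_nat hκ (hB (tB δ)) fun β k => h₁ (walk f β.1 δ k)
    obtain ⟨q, hq⟩ := hΛ.exists_fiber hL hKM t
    refine ⟨Λ, q, hq.mono ?_⟩
    rintro δ ⟨⟨⟨h1, h2⟩, rfl⟩, rfl⟩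
    exact ⟨h1, h2, fun β hβ => hr' δ h1 ⟨β, hβ⟩, fun β hβ k => ht δ ⟨β, hβ⟩ k⟩
  choose Λ₁ t₁ hS₁ using step₁
  obtain ⟨t₀, ht₀⟩ := hM.exists_unbounded_fiber (Q := K) le_rfl (A := Set.univ)
    (fun x => ⟨x, trivial, le_rfl⟩) t₁
  choose d hd hd' using fun i => (hS₁ i).exists_gt fun δ hδ => hSpos δ hδ.1
  -- Fodor's lemma for nodes `δ` with mark `θ` and the node `d i δ` with index `i` above `δ`.
  have step₂ : ∀ (i : M) (θ : K), ∃ Λ : L, Stationary {δ | δ ∈ S ∧ h₁ δ = θ ∧ Passes f (d i δ) δ Λ} := by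
    intro i θ
    choose! r hr hr' using fun δ (hδ : δ ∈ S) => hf.exists_passes hK0 hM hδ (hd' i δ)
    obtain ⟨Λ, hΛ⟩ := (hG₁ θ).fodor hL hM0 r fun δ hδ => hr δ hδ.1
    refine ⟨Λ, hΛ.mono ?_⟩
    rintro δ ⟨⟨h1, h2⟩, rfl⟩
    exact ⟨h1, h2, hr' δ h1⟩
  choose Λ₂ hS₂ using step₂
  obtain ⟨Λ₁', hΛ₁'⟩ := hL.bdd_range Λ₁ le_rfl
  obtain ⟨Λ₂', hΛ₂'⟩ := hL.bdd_range_prod le_rfl hKM Λ₂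
  choose FA hFA using fun z => hL.bdd (A (sA z)) ((hA _).trans (hκK.trans hKM))
  obtain ⟨δ, ⟨hδS, hδγ⟩, hδc⟩ := hGg γ fun z => max (FA z) (max Λ₁' Λ₂')
  obtain ⟨x₀, hx₀⟩ := hSpos δ hδS
  have hδ₁ : ∀ i, Λ₁ i < δ := fun i => (hΛ₁' i).trans
    (((le_max_left _ _).trans (le_max_right _ _)).trans_lt (hδc x₀ hx₀))
  have hδ₂ : ∀ i θ, Λ₂ i θ < δ := fun i θ => (hΛ₂' i θ).trans
    (((le_max_right _ _).trans (le_max_right _ _)).trans_lt (hδc x₀ hx₀))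
  choose d₁ hd₁ hd₁' using fun i θ => (hS₂ i θ).exists_gt (fun δ hδ => hSpos δ hδ.1) δ
  set d₂ : M → K → L := fun i θ => d i (d₁ i θ) with hd₂
  set b : M → K → Set L := fun i θ => B (tB (d₂ i θ)) with hb
  have hδb : ∀ i θ, ∀ β : b i θ, δ < β.1 := fun i θ β =>
    (hd₁' i θ).trans ((hd' i _).trans (htB _ _ β.2))
  choose τ hτ using fun i θ => hK.bdd_range_nat hκ (hB (tB (d₂ i θ))) fun β k => h₁ (walk f β.1 δ k)
  have step₃ : ∀ θ : K, ∃ t : K, ∀ x, ∃ i ∈ {i | t₁ i = t₀}, τ i θ = t ∧ x ≤ i := fun θ =>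
    hM.exists_unbounded_fiber (Q := K) le_rfl (fun x => by
      obtain ⟨y, -, h, h'⟩ := ht₀ x
      exact ⟨y, h, h'⟩) fun i => τ i θ
  choose T hT using step₃
  -- For each `θ`, a sequence `s θ` of indices of length `K` such that the letters `≥ s θ ν` between
  -- `d₂ (s θ ν) θ` and `δ` form pairwise disjoint sets for different `ν`.
  have step₄ : ∀ θ : K, ∃ s : K → {i // t₁ i = t₀ ∧ τ i θ = T θ}, ∀ ν ν', ν < ν' →
      ∀ k, letter f h₂ δ (walk f (d₂ (s ν) θ) δ k) < (s ν').1 := by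
    intro θ
    refine exists_chain hK.mk_Iio_le (fun a c : {i // t₁ i = t₀ ∧ τ i θ = T θ} =>
      ∀ k, letter f h₂ δ (walk f (d₂ a θ) δ k) < c.1) fun U hU => ?_
    obtain ⟨y, hy⟩ := hM.bdd_range_nat hK0 (hU.trans hκK) fun (a : U) k =>
      letter f h₂ δ (walk f (d₂ a.1 θ) δ k)
    obtain ⟨i, hi, hi', hyi⟩ := hT θ y
    exact ⟨⟨i, hi, hi'⟩, fun a ha k => (hy ⟨a, ha⟩ k).trans_le hyi⟩
  choose s hs using step₄
  -- Only `#K` many upper blocks are left, so that the bounds `Λ₃` stay below `δ` and the letters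
  -- above `δ` stay below some `max j₁' j₂'`.
  choose Λ₃ hΛ₃ hΛ₃' using fun (θ ν : K) => hf.exists_passes_set hK0 hM hδS
    ((hB _).trans hκK) (fun β : b (s θ ν) θ => β.1) (hδb _ _)
  obtain ⟨Λ₄, hΛ₄, hΛ₄'⟩ := HighCof.bdd_range hδS (ι := K × K)
    (by rw [← mul_def]; exact (mul_eq_self hK0).le) (fun p => Λ₃ p.1 p.2) fun p => hΛ₃ p.1 p.2
  choose j₁ hj₁ using fun (θ ν : K) => hM.bdd_range_nat hK0
    ((hB (tB (d₂ (s θ ν) θ))).trans hκK) fun β k => letter f h₂ δ (walk f β.1 δ k)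
  obtain ⟨j₁', hj₁'⟩ := hM.bdd_range_prod le_rfl le_rfl j₁
  choose j₂ hj₂ using fun (θ : K) => hM.bdd_range_nat hK0 le_rfl
    fun ν k => letter f h₂ δ (walk f (d₂ (s θ ν) θ) δ k)
  obtain ⟨j₂', hj₂'⟩ := hM.bdd_range j₂ le_rfl
  obtain ⟨Λ₅, hΛ₅, hΛ₅'⟩ := hf.exists_lt_level hK0 hM hδS (max j₁' j₂')
  -- The lower block `A (sA z)`, close enough to `δ` for the level of `δ` to be the record.
  set z := max Λ₄ Λ₅ with hz
  have hzδ : z < δ := max_lt hΛ₄ hΛ₅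
  have hzα : ∀ α ∈ A (sA z), z < α := hsA z
  have hαδ : ∀ α ∈ A (sA z), α < δ := fun α hα =>
    (hFA z α hα).trans ((le_max_left _ _).trans_lt (hδc z hzδ))
  have hlev : ∀ α ∈ A (sA z), max j₁' j₂' < level f δ α := fun α hα =>
    hΛ₅' α ((le_max_right _ _).trans (hzα α hα).le) (hαδ α hα)
  obtain ⟨θ₁, hθ₁⟩ := hK.bdd_range_nat hκ (hA (sA z)) fun α k => h₁ (walk f δ α.1 k)
  have hmax : ∀ α : A (sA z), ∃ ζ, (∃ k < walkLen f δ α, letter f h₂ α (walk f δ α k) = ζ) ∧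
      (∀ k < walkLen f δ α, letter f h₂ α (walk f δ α k) ≤ ζ) ∧ level f δ α ≤ ζ := by
    intro α
    have hpos : 0 < walkLen f δ α := by
      by_contra hc
      have := hf.walk_walkLen (hαδ α α.2).le
      rw [show walkLen f δ α = 0 by omega, walk_zero] at this
      exact (hαδ α α.2).ne' this
    obtain ⟨k, hk, h⟩ := (Finset.range (walkLen f δ α)).exists_max_image
      (fun k => letter f h₂ α (walk f δ α k)) ⟨0, by simpa using hpos⟩
    refine ⟨_, ⟨k, by simpa using hk, rfl⟩, fun k hk => h k (by simpa using hk), ?_⟩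
    exact (le_max_right _ _).trans (h 0 (by simpa using hpos))
  choose ζ hζ hζm hζl using hmax
  obtain ⟨θ₂, hθ₂⟩ := hK.bdd_range (fun α : A (sA z) => e (ζ α) (letter f h₂ α δ)) (hA _)
  set θ := max t₀ (max θ₁ θ₂) with hθ
  have hlt : ∀ (α : A (sA z)) ν k, letter f h₂ δ (walk f (d₂ (s θ ν) θ) δ k) < ζ α := fun α ν k =>
    ((hj₂ θ ν k).trans (hj₂' θ)).trans
      (((le_max_right _ _).trans_lt (hlev α α.2)).trans_le (hζl α))
  -- Each `e (ζ α)` takes values `≤ T θ` at most `κ` times, and there are more than `κ` many `ν`.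
  obtain ⟨ν, hν⟩ : ∃ ν, ∀ (α : A (sA z)) k, (s θ ν).1 ≤ letter f h₂ δ (walk f (d₂ (s θ ν) θ) δ k) →
      T θ < e (ζ α) (letter f h₂ δ (walk f (d₂ (s θ ν) θ) δ k)) := by
    by_contra hc
    push Not at hc
    choose a k hk hk' using hc
    have hinj : Function.Injective fun ν => ((a ν, ⟨_, hk' ν⟩) : A (sA z) × Set.Iic (T θ)) := by
      intro ν ν' hνν'
      have h1 : a ν = a ν' := congrArg Prod.fst hνν'
      have h2 : e (ζ (a ν)) _ = e (ζ (a ν')) _ := congrArg (fun p => p.2.1) hνν'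
      rw [← h1] at h2
      have h3 := he _ (hlt _ _ _) (hlt _ _ _) h2
      rcases lt_trichotomy ν ν' with hlt' | heq | hlt'
      · exact absurd (h3 ▸ hk ν') (not_le.2 (hs θ ν ν' hlt' (k ν)))
      · exact heq
      · exact absurd (h3 ▸ hk ν) (not_le.2 (hs θ ν' ν hlt' (k ν')))
    have h4 := mk_le_of_injective hinj
    rw [← mul_def] at h4
    exact absurd (h4.trans ((mul_le_mul' (hA _) (hK.mk_Iic_le hκ _)).trans (mul_eq_self hκ).le))
      (not_le.2 hK.lt_mk)
  refine ⟨sA z, tB (d₂ (s θ ν) θ), δ, hαδ, fun β hβ => hδb _ _ ⟨β, hβ⟩, fun α hα β hβ => ?_⟩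
  obtain ⟨-, hi, hp₂, hp₂'⟩ := hd (s θ ν) (d₁ (s θ ν) θ)
  obtain ⟨-, hθd, hp₁⟩ := hd₁ (s θ ν) θ
  rw [← hδγ]
  refine walkColour_eq hf (hαδ α hα) (hd₁' (s θ ν) θ) (hd' _ _) (htB _ β hβ) (hp₂ β hβ)
    (hδ₁ _).le hp₁ (hδ₂ _ _).le (hΛ₃' θ ν ⟨β, hβ⟩)
    ((hΛ₄' (θ, ν)).le.trans ((le_max_left _ _).trans (hzα α hα).le)) hi hθd
    (τ := T θ) (ζ := ζ ⟨α, hα⟩) (fun k => ?_) (fun k => ?_) (fun k => ?_) (fun k => ?_)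
    (hζ ⟨α, hα⟩) (hζm ⟨α, hα⟩) (hν ⟨α, hα⟩) ?_
  · exact (s θ ν).2.2 ▸ (hτ (s θ ν) θ ⟨β, hβ⟩ k).le
  · exact (hp₂' β hβ k).trans_le ((s θ ν).2.1.le.trans (le_max_left _ _))
  · exact (hθ₁ ⟨α, hα⟩ k).trans_le ((le_max_left _ _).trans (le_max_right _ _))
  · exact ((hj₁ θ ν ⟨β, hβ⟩ k).trans (hj₁' θ ν)).trans ((le_max_left _ _).trans_lt (hlev α hα))
  · exact (hθ₂ ⟨α, hα⟩).le.trans ((le_max_right _ _).trans (le_max_right _ _))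

end Colouring

/-! ### Prescribed patterns on finite blocks, and transfer to cardinals -/

section Patterns

variable {L M : Type v}

open Classical in
/-- The trace on the finite set `v` of the set `η x` coded by `x`. -/
noncomputable def trace (η : L → Set M) (v : Finset M) (x : L) : Finset M := {y ∈ v | y ∈ η x}

theorem exists_injOn_trace {η : L → Set M} (hη : Function.Injective η) (F : Finset L) :
    ∃ v : Finset M, Set.InjOn (trace η v) F := by
  classical
  have hsep : ∀ x y : L, x ≠ y → ∃ m, ¬ (m ∈ η x ↔ m ∈ η y) := fun x y hxy => by
    by_contra hc
    push Not at hc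
    exact hxy (hη (Set.ext hc))
  rcases isEmpty_or_nonempty M with hM | hM
  · refine ⟨∅, fun x _ y _ _ => hη (Set.ext fun m => (hM.false m).elim)⟩
  choose! m hm using hsep
  refine ⟨(F ×ˢ F).image fun p => m p.1 p.2, fun x hx y hy hxy => ?_⟩
  by_contra hne
  refine hm x y hne ?_
  have hmem : m x y ∈ (F ×ˢ F).image fun p => m p.1 p.2 :=
    Finset.mem_image.2 ⟨(x, y), Finset.mem_product.2 ⟨hx, hy⟩, rfl⟩
  have := Finset.ext_iff.1 hxy (m x y)
  simpa [trace, hmem] using this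

variable {K : Type v} [LinearOrder K] [LinearOrder L] [LinearOrder M] [WellFoundedLT K]
  [WellFoundedLT L] [WellFoundedLT M]

/-- A colouring that realises prescribed colours `H s α` depending on the point `α` of a finite lower
block `F s`, for values in a set `W` of size at most `#M`. The sets `E s` are not coloured; they
only have to end up below `δ` as well. -/
theorem exists_patterned_colouring {κ : Cardinal.{v}} (hκ : ℵ₀ ≤ κ) (hK : SuccLike K κ)
    (hM : SuccLike M #K) (hL : SuccLike L #M) :
    ∃ c : L → L → L, ∀ (F : L → Finset L) (H : L → L → L) (W : Set L) (E B : L → Set L),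
      #W ≤ #M → (∀ s, ∀ x ∈ F s, H s x ∈ W) → (∀ s, #(E s) ≤ κ) → (∀ t, #(B t) ≤ κ) →
      (∀ z, ∃ s, (∀ x ∈ F s, z < x) ∧ ∀ x ∈ E s, z < x) → (∀ z, ∃ t, ∀ x ∈ B t, z < x) →
      ∃ s t δ, (∀ α ∈ F s, α < δ) ∧ (∀ x ∈ E s, x < δ) ∧ (∀ β ∈ B t, δ < β) ∧
        ∀ α ∈ F s, ∀ β ∈ B t, c α β = H s α := by
  classical
  have hM0 : ℵ₀ ≤ #M := (hκ.trans hK.lt_mk.le).trans hM.lt_mk.le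
  have hL0 : ℵ₀ ≤ #L := hM0.trans hL.lt_mk.le
  have := infinite_iff.2 hM0
  have := infinite_iff.2 hL0
  obtain ⟨c, hc⟩ := exists_strong_colouring hκ hK hM hL
  -- Since `#L ≤ (#M)⁺ ≤ 2 ^ #M`, the points of `L` can be coded by subsets of `M`.
  obtain ⟨⟨η, hη⟩⟩ : Nonempty (L ↪ Set M) := (Cardinal.le_def _ _).1 <| by
    rw [mk_set]
    exact (hL.mk_le_succ hM0).trans (Order.succ_le_of_lt (cantor _))
  obtain ⟨dec, hdec⟩ : ∃ dec : L → Finset M × Finset (Finset M × L), Function.Surjective dec := by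
    have h1 : #(Finset M × Finset (Finset M × L)) ≤ #L := by
      rw [← mul_def, mk_finset_of_infinite, mk_finset_of_infinite, ← mul_def,
        mk_finset_of_infinite]
      exact (mul_le_mul' hL.lt_mk.le ((mul_le_mul' hL.lt_mk.le le_rfl).trans
        (mul_eq_self hL0).le)).trans (mul_eq_self hL0).le
    obtain ⟨i⟩ := (Cardinal.le_def _ _).1 h1
    exact ⟨Function.invFun i, Function.invFun_surjective i.injective⟩
  refine ⟨fun α β => if h : ∃ y, (trace η (dec (c α β)).1 α, y) ∈ (dec (c α β)).2 then h.choose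
    else α, fun F H W E B hW hH hE hB hA hBu => ?_⟩
  choose v hv using fun s => exists_injOn_trace hη (F s)
  choose s hsF hsE using hA
  have hQ : #(Finset M × Finset (Finset M × W)) ≤ #M := by
    have h1 : #(Finset (Finset M × W)) ≤ #(Finset (Finset M × M)) := by
      obtain ⟨i⟩ := (Cardinal.le_def _ _).1 hW
      exact mk_le_of_injective (Finset.map_injective ((Function.Embedding.refl _).prodMap i))
    rw [← mul_def]
    refine (mul_le_mul' le_rfl h1).trans ?_
    rw [mk_finset_of_infinite, mk_finset_of_infinite, ← mul_def, mk_finset_of_infinite,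
      mul_eq_self hM0, mul_eq_self hM0]
  obtain ⟨⟨v₀, Q⟩, hq⟩ := hL.exists_unbounded_fiber hQ (A := Set.univ)
    (fun x => ⟨x, trivial, le_rfl⟩) fun z : L => (v (s z), (F (s z)).attach.image fun x : F (s z) =>
      (trace η (v (s z)) x.1, (⟨H (s z) x.1, hH _ _ x.2⟩ : W)))
  choose z _ hz hz' using hq
  obtain ⟨γ, hγ⟩ := hdec (v₀, Q.image fun p => (p.1, (p.2 : L)))
  obtain ⟨x, t, δ, h1, h2, h3⟩ := hc (fun x => (F (s (z x)) : Set L) ∪ E (s (z x))) B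
    (fun x => ((mk_union_le _ _).trans (add_le_add
      ((Finset.countable_toSet _).le_aleph0.trans hκ) (hE _))).trans (add_eq_self hκ).le) hB
    (fun y => ⟨y, by
      rintro x (hx | hx)
      · exact (hz' y).trans_lt (hsF _ x hx)
      · exact (hz' y).trans_lt (hsE _ x hx)⟩) hBu γ
  refine ⟨s (z x), t, δ, fun α hα => h1 α (Or.inl hα), fun y hy => h1 y (Or.inr hy), h2,
    fun α hα β hβ => ?_⟩
  have hz1 : v (s (z x)) = v₀ := congrArg Prod.fst (hz x)
  have hz2 := congrArg Prod.snd (hz x)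
  simp only at hz2
  have hcα : c α β = γ := h3 α (Or.inl hα) β hβ
  have hmem : ∀ y, (trace η v₀ α, y) ∈ Q.image (fun p => (p.1, (p.2 : L))) ↔
      y = H (s (z x)) α := by
    intro y
    rw [← hz2, ← hz1]
    simp only [Finset.mem_image, Finset.mem_attach, true_and, Subtype.exists, Prod.exists,
      Prod.mk.injEq]
    constructor
    · rintro ⟨_, w, hw, ⟨x', hx', rfl, hx''⟩, hxα, rfl⟩
      rw [← hv _ hx' hα hxα]
      exact (congrArg Subtype.val hx'').symm
    · rintro rfl
      exact ⟨_, _, hH _ _ hα, ⟨α, hα, rfl, rfl⟩, rfl, rfl⟩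
  have hex : ∃ y, (trace η (dec (c α β)).1 α, y) ∈ (dec (c α β)).2 := by
    rw [hcα, hγ]
    exact ⟨_, (hmem _).2 rfl⟩
  refine (dif_pos hex).trans ?_
  have h4 := hex.choose_spec
  generalize hex.choose = y at h4
  rw [hcα, hγ] at h4
  exact (hmem y).1 h4

end Patterns

section Ordinals

theorem succLike_toType {c : Cardinal.{u}} (hc : ℵ₀ ≤ c) :
    SuccLike (Order.succ c).ord.ToType c where
  mk_Iio_le x := Order.lt_succ_iff.1 (by simpa using mk_Iio_lt x (by simp))
  bdd s hs := by
    by_contra h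
    push Not at h
    have h1 : IsCofinal s := fun y => h y
    have h2 := (Order.cof_le h1).trans hs
    rw [Ordinal.cof_toType, (isRegular_succ hc).cof_ord] at h2
    exact absurd (Order.lt_succ c) (not_lt.2 h2)

theorem mk_below (c : Cardinal.{u}) : #(Below c) = lift.{u + 1} c := by
  rw [mk_Iio_ordinal, card_ord]

theorem succLike_below {c : Cardinal.{u}} (hc : ℵ₀ ≤ c) :
    SuccLike (Below (Order.succ c)) (lift.{u + 1} c) where
  mk_Iio_le x := by
    have h1 := lift_mk_le_lift_mk_of_injective
      (f := fun y : Set.Iio x => (⟨Ordinal.ToType.mk y.1, Ordinal.ToType.mk.lt_iff_lt.2 y.2⟩ :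
        Set.Iio (Ordinal.ToType.mk x))) (fun y z h => by simpa [Subtype.ext_iff] using h)
    have h2 := lift_le.{u + 1}.2 ((succLike_toType hc).mk_Iio_le (Ordinal.ToType.mk x))
    exact (lift_id'.{u, u + 1} _).symm.le.trans (h1.trans h2)
  bdd s hs := by
    have h1 : #(Ordinal.ToType.mk '' s) ≤ c := by
      have h := (mk_image_le_lift (f := Ordinal.ToType.mk) (s := s)).trans (lift_le.{u}.2 hs)
      simpa using h
    obtain ⟨y, hy⟩ := (succLike_toType hc).bdd _ h1
    refine ⟨Ordinal.ToType.mk.symm y, fun x hx => ?_⟩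
    rw [OrderIso.lt_symm_apply]
    exact hy _ ⟨x, hx, rfl⟩

/-- Pairwise disjoint blocks: only `m` many of them can meet `Iic z`. -/
theorem SuccLike.exists_block_gt {L : Type v} [LinearOrder L] {m : Cardinal.{v}}
    (hL : SuccLike L m) (hm : ℵ₀ ≤ m) {I : Type*} (ζ : L → I → L)
    (hζ : ∀ a b i j, ζ a i = ζ b j → a = b) (z : L) : ∃ s, z < s ∧ ∀ i, z < ζ s i := by
  have h1 : #{s | ∃ i, ζ s i ≤ z} ≤ m := by
    choose i hi using fun s : {s | ∃ i, ζ s i ≤ z} => s.2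
    have hinj : Function.Injective fun s : {s | ∃ i, ζ s i ≤ z} =>
        (⟨ζ s (i s), hi s⟩ : Set.Iic z) := fun a b hab =>
      Subtype.ext (hζ _ _ _ _ (congrArg Subtype.val hab))
    exact (mk_le_of_injective hinj).trans (hL.mk_Iic_le hm z)
  obtain ⟨y, hy⟩ := hL.bdd _ h1
  obtain ⟨s, hs⟩ := hL.exists_gt hm (max y z)
  refine ⟨s, (le_max_right _ _).trans_lt hs, fun i => not_le.1 fun hc => ?_⟩
  exact absurd (hy s ⟨i, hc⟩) (not_lt.2 ((le_max_left _ _).trans hs.le))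

theorem mk_Iio_le_lift {c : Cardinal.{u}} {i : Ordinal.{u}} (hi : i < (Order.succ c).ord) :
    #(Set.Iio i) ≤ lift.{u + 1} c := by
  rw [mk_Iio_ordinal, Cardinal.lift_le]
  exact Order.lt_succ_iff.1 (lt_ord.1 hi)

/-- The symmetric colouring induced by a colouring of the increasing pairs. -/
def symColour {L C : Type*} [LinearOrder L] (c : L → L → C) : Sym2 L → C :=
  Sym2.lift ⟨fun a b => c (min a b) (max a b), fun a b => by simp only [min_comm, max_comm]⟩

theorem symColour_of_lt {L C : Type*} [LinearOrder L] (c : L → L → C) {a b : L} (h : a < b) :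
    symColour c s(a, b) = c a b := by
  simp [symColour, min_eq_left h.le, max_eq_right h.le]

theorem pr1_succ_succ_succ {κ : Cardinal.{u}} (hκ : ℵ₀ ≤ κ) :
    Pr1 (Order.succ (Order.succ (Order.succ κ))) (Order.succ (Order.succ (Order.succ κ)))
      (Order.succ (Order.succ (Order.succ κ))) κ (Order.succ κ) := by
  have hκ1 : ℵ₀ ≤ Order.succ κ := hκ.trans (Order.le_succ _)
  have hκ2 : ℵ₀ ≤ Order.succ (Order.succ κ) := hκ1.trans (Order.le_succ _)
  have hκl : ℵ₀ ≤ lift.{u + 1} κ := aleph0_le_lift.2 hκ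
  have hL0 := succLike_below hκ2
  obtain ⟨c, hc⟩ := exists_strong_colouring hκl (succLike_below hκ)
    (M := Below (Order.succ (Order.succ κ))) ((mk_below _) ▸ succLike_below hκ1)
    (L := Below (Order.succ (Order.succ (Order.succ κ)))) ((mk_below _) ▸ hL0)
  refine ⟨symColour c, fun b γ => ?_⟩
  have hcard : ∀ {i : Ordinal.{u}} (ζ : Set.Iio i → Below (Order.succ (Order.succ (Order.succ κ))))
      (s : Below (Order.succ (Order.succ (Order.succ κ)))), i < (Order.succ κ).ord →
      #(insert s (Set.range ζ) : Set _) ≤ lift.{u + 1} κ := fun ζ s hi =>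
    (mk_insert_le).trans ((add_le_add (mk_range_le.trans (mk_Iio_le_lift hi))
      (one_le_aleph0.trans hκl)).trans (add_eq_self hκl).le)
  obtain ⟨s, t, δ, h1, h2, h3⟩ := hc (fun s => insert s (Set.range (b.ζ₀ s)))
    (fun t => insert t (Set.range (b.ζ₁ t)))
    (fun s => hcard _ _ (b.i₀_lt.trans (ord_lt_ord.2 (Order.lt_succ κ))))
    (fun t => hcard _ _ b.i₁_lt)
    (fun z => by
      obtain ⟨s, hs, h⟩ := hL0.exists_block_gt (aleph0_le_lift.2 hκ2) b.ζ₀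
        (fun a c i j h => (b.ζ₀_inj a c i j h).1) z
      exact ⟨s, by rintro x (rfl | ⟨i, rfl⟩); exacts [hs, h i]⟩)
    (fun z => by
      obtain ⟨s, hs, h⟩ := hL0.exists_block_gt (aleph0_le_lift.2 hκ2) b.ζ₁
        (fun a c i j h => (b.ζ₁_inj a c i j h).1) z
      exact ⟨s, by rintro x (rfl | ⟨i, rfl⟩); exacts [hs, h i]⟩) γ
  refine ⟨s, t, (h1 _ (Or.inl rfl)).trans (h2 _ (Or.inl rfl)), fun i j => ?_⟩
  rw [symColour_of_lt _ ((h1 _ (Or.inr ⟨i, rfl⟩)).trans (h2 _ (Or.inr ⟨j, rfl⟩)))]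
  exact h3 _ (Or.inr ⟨i, rfl⟩) _ (Or.inr ⟨j, rfl⟩)

theorem pr00_succ_succ_succ {κ : Cardinal.{u}} (hκ : ℵ₀ ≤ κ) :
    Pr00 (Order.succ (Order.succ (Order.succ κ))) (Order.succ (Order.succ (Order.succ κ)))
      (Order.succ (Order.succ (Order.succ κ))) ℵ₀ (Order.succ κ) := by
  classical
  have hκ1 : ℵ₀ ≤ Order.succ κ := hκ.trans (Order.le_succ _)
  have hκ2 : ℵ₀ ≤ Order.succ (Order.succ κ) := hκ1.trans (Order.le_succ _)
  have hκl : ℵ₀ ≤ lift.{u + 1} κ := aleph0_le_lift.2 hκ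
  have hL0 := succLike_below hκ2
  obtain ⟨c, hc⟩ := exists_patterned_colouring hκl (succLike_below hκ)
    (M := Below (Order.succ (Order.succ κ))) ((mk_below _) ▸ succLike_below hκ1)
    (L := Below (Order.succ (Order.succ (Order.succ κ)))) ((mk_below _) ▸ hL0)
  refine ⟨symColour c, fun b h => ?_⟩
  have hfin : Finite (Set.Iio b.i₀) := by
    rw [← lt_aleph0_iff_finite, mk_Iio_ordinal, lift_lt_aleph0]
    exact lt_ord.1 b.i₀_lt
  have hinj : ∀ s, Function.Injective (b.ζ₀ s) := fun s i j hij => (b.ζ₀_inj s s i j hij).2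
  have hext : ∀ s i, Function.extend (b.ζ₀ s) h (fun x => x) (b.ζ₀ s i) = h i := fun s i =>
    (hinj s).extend_apply h _ i
  have hmem : ∀ s x, x ∈ (Set.finite_range (b.ζ₀ s)).toFinset ↔ ∃ i, b.ζ₀ s i = x := fun s x => by
    simp
  obtain ⟨s, t, δ, h1, h2, h3, h4⟩ := hc (fun s => (Set.finite_range (b.ζ₀ s)).toFinset)
    (fun s => Function.extend (b.ζ₀ s) h fun x => x) (Set.range h) (fun s => {s})
    (fun t => insert t (Set.range (b.ζ₁ t)))
    ((Set.finite_range h).countable.le_aleph0.trans (by rw [mk_below]; exact aleph0_le_lift.2 hκ2))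
    (fun s x hx => by
      obtain ⟨i, rfl⟩ := (hmem s x).1 hx
      exact ⟨i, (hext s i).symm⟩)
    (fun s => (Set.countable_singleton s).le_aleph0.trans hκl)
    (fun t => (mk_insert_le).trans ((add_le_add (mk_range_le.trans (mk_Iio_le_lift b.i₁_lt))
      (one_le_aleph0.trans hκl)).trans (add_eq_self hκl).le))
    (fun z => by
      obtain ⟨s, hs, h⟩ := hL0.exists_block_gt (aleph0_le_lift.2 hκ2) b.ζ₀
        (fun a c i j h => (b.ζ₀_inj a c i j h).1) z
      refine ⟨s, fun x hx => ?_, by rintro x rfl; exact hs⟩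
      obtain ⟨i, rfl⟩ := (hmem s x).1 hx
      exact h i)
    (fun z => by
      obtain ⟨s, hs, h⟩ := hL0.exists_block_gt (aleph0_le_lift.2 hκ2) b.ζ₁
        (fun a c i j h => (b.ζ₁_inj a c i j h).1) z
      exact ⟨s, by rintro x (rfl | ⟨i, rfl⟩); exacts [hs, h i]⟩)
  refine ⟨s, t, (h2 _ rfl).trans (h3 _ (Or.inl rfl)), fun i j => ?_⟩
  have hi := (hmem s _).2 ⟨i, rfl⟩
  rw [symColour_of_lt _ ((h1 _ hi).trans (h3 _ (Or.inr ⟨j, rfl⟩)))]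
  exact (h4 _ hi _ (Or.inr ⟨j, rfl⟩)).trans (hext s i)

end Ordinals

/-! ### The space -/

section Topology

theorem mk_finset_le_of_aleph0_le {α : Type v} {m : Cardinal.{v}} (hm : ℵ₀ ≤ m) (hα : #α ≤ m) :
    #(Finset α) ≤ m := by
  rcases finite_or_infinite α with h | h
  · exact mk_le_aleph0.trans hm
  · exact (mk_finset_of_infinite α).le.trans hα

variable {L : Type v}

theorem exists_cylinder_subset {U : Set (L → Bool)} (hU : IsOpen U) {x : L → Bool} (hx : x ∈ U) :
    ∃ F : Finset L, ∀ y : L → Bool, (∀ β ∈ F, y β = x β) → y ∈ U := by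
  obtain ⟨F, u, hu, h⟩ := isOpen_pi_iff.1 hU x hx
  exact ⟨F, fun y hy => h fun β hβ => by rw [hy β hβ]; exact (hu β hβ).2⟩

theorem isClopen_cylinder (F : Finset L) (x : L → Bool) :
    IsClopen {y : L → Bool | ∀ β ∈ F, y β = x β} := by
  have : {y : L → Bool | ∀ β ∈ F, y β = x β} = (F : Set L).pi fun β => {x β} := by
    ext y; simp [Set.mem_pi]
  rw [this]
  exact ⟨isClosed_set_pi fun _ _ => isClosed_discrete _,
    isOpen_set_pi F.finite_toSet fun _ _ => isOpen_discrete _⟩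

theorem mem_closure_iff_cylinder {A : Set (L → Bool)} {x : L → Bool} :
    x ∈ closure A ↔ ∀ F : Finset L, ∃ y ∈ A, ∀ β ∈ F, y β = x β := by
  rw [mem_closure_iff]
  constructor
  · intro h F
    obtain ⟨y, hy, hyA⟩ := h _ (isClopen_cylinder F x).isOpen fun _ _ => rfl
    exact ⟨y, hyA, hy⟩
  · intro h U hU hx
    obtain ⟨F, hF⟩ := exists_cylinder_subset hU hx
    obtain ⟨y, hyA, hy⟩ := h F
    exact ⟨y, hF y hy, hyA⟩

theorem isOpen_coord_eq (X : Set (L → Bool)) (β : L) (v : Bool) : IsOpen {x : X | x.1 β = v} := by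
  have hβ : Continuous fun x : X => x.1 β := (continuous_apply β).comp continuous_subtype_val
  exact (isOpen_discrete ({v} : Set Bool)).preimage hβ

theorem isTopologicalBasis_cylinder (X : Set (L → Bool)) :
    TopologicalSpace.IsTopologicalBasis
      (Set.range fun s : Finset (L × Bool) => {x : X | ∀ p ∈ s, x.1 p.1 = p.2}) := by
  refine TopologicalSpace.isTopologicalBasis_of_isOpen_of_nhds ?_ ?_
  · rintro _ ⟨s, rfl⟩
    change IsOpen {x : X | ∀ p ∈ s, x.1 p.1 = p.2}
    have : {x : X | ∀ p ∈ s, x.1 p.1 = p.2} = ⋂ p ∈ s, {x : X | x.1 p.1 = p.2} := by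
      ext x; simp
    rw [this]
    exact isOpen_biInter_finset fun p _ => isOpen_coord_eq X p.1 p.2
  · rintro x U hx hU
    obtain ⟨V, hV, rfl⟩ := isOpen_induced_iff.1 hU
    obtain ⟨F, hF⟩ := exists_cylinder_subset hV hx
    classical
    refine ⟨_, ⟨F.image fun β => (β, x.1 β), rfl⟩, ?_, fun y hy => hF y.1 fun β hβ => ?_⟩
    · intro p hp
      obtain ⟨β, -, rfl⟩ := Finset.mem_image.1 hp
      rfl
    · exact hy _ (Finset.mem_image_of_mem _ hβ)

theorem isTopologicalBasis_isClopen (X : Set (L → Bool)) :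
    TopologicalSpace.IsTopologicalBasis {s : Set X | IsClopen s} := by
  refine TopologicalSpace.isTopologicalBasis_of_isOpen_of_nhds (fun s hs => hs.2) ?_
  rintro x U hx hU
  obtain ⟨V, hV, rfl⟩ := isOpen_induced_iff.1 hU
  obtain ⟨F, hF⟩ := exists_cylinder_subset hV hx
  exact ⟨_, (isClopen_cylinder F x.1).preimage continuous_subtype_val, fun _ _ => rfl,
    fun y hy => hF y.1 hy⟩

theorem weight_le (hL : ℵ₀ ≤ #L) (X : Set (L → Bool)) : weight X ≤ #L := by
  have h : weight X ≤ #(Set.range fun s : Finset (L × Bool) => {x : X | ∀ p ∈ s, x.1 p.1 = p.2}) :=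
    csInf_le' ⟨_, isTopologicalBasis_cylinder X, rfl⟩
  refine h.trans (mk_range_le.trans ?_)
  refine mk_finset_le_of_aleph0_le hL ?_
  rw [mk_prod, lift_uzero, mk_bool]
  simpa using (mul_le_mul' le_rfl ((natCast_lt_aleph0 (n := 2)).le.trans hL)).trans
    (mul_eq_self hL).le

variable [LinearOrder L]

/-- A two-valued colouring that realises arbitrary patterns on finite lower blocks `F s`, uniformly
over countable upper blocks `B t`. The countable sets `E s` are required to lie below the upper
block too. -/
def RealisesPatterns (c : L → L → Bool) : Prop :=
  ∀ (F : L → Finset L) (H : L → L → Bool) (E B : L → Set L),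
    (∀ s, (E s).Countable) → (∀ t, (B t).Countable) →
    (∀ z, ∃ s, (∀ x ∈ F s, z < x) ∧ ∀ x ∈ E s, z < x) → (∀ z, ∃ t, ∀ x ∈ B t, z < x) →
    ∃ s t δ, (∀ α ∈ F s, α < δ) ∧ (∀ x ∈ E s, x < δ) ∧ (∀ β ∈ B t, δ < β) ∧
      ∀ α ∈ F s, ∀ β ∈ B t, c α β = H s α

theorem exists_realisesPatterns {K M : Type v} [LinearOrder K] [LinearOrder M] [WellFoundedLT K]
    [WellFoundedLT L] [WellFoundedLT M] (hK : SuccLike K ℵ₀) (hM : SuccLike M #K)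
    (hL : SuccLike L #M) : ∃ c : L → L → Bool, RealisesPatterns c := by
  classical
  obtain ⟨c, hc⟩ := exists_patterned_colouring le_rfl hK hM hL
  have hM0 : ℵ₀ ≤ #M := hK.lt_mk.le.trans hM.lt_mk.le
  obtain ⟨w₀⟩ := hL.nonempty
  obtain ⟨w₁, hw⟩ := hL.exists_gt hM0 w₀
  refine ⟨fun α β => decide (c α β = w₁), fun F H E B hE hB hA hBu => ?_⟩
  obtain ⟨s, t, δ, h1, h2, h3, h4⟩ := hc F (fun s x => if H s x then w₁ else w₀) {w₁, w₀} E B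
    ((Set.to_countable _).le_aleph0.trans hM0) (fun s x _ => by split_ifs <;> simp)
    (fun s => (hE s).le_aleph0) (fun t => (hB t).le_aleph0) hA hBu
  refine ⟨s, t, δ, h1, h2, h3, fun α hα β hβ => ?_⟩
  simp only [h4 α hα β hβ]
  cases H s α <;> simp [hw.ne]

/-- Beyond some `Λ`, every pattern on every finite set is realised by a single point: otherwise
there would be unrealised patterns on finite sets beyond every point. -/
theorem RealisesPatterns.exists_bound {m : Cardinal.{v}} {c : L → L → Bool}
    (hc : RealisesPatterns c) (hL : SuccLike L m) (hm : ℵ₀ ≤ m) :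
    ∃ Λ, ∀ F : Finset L, (∀ β ∈ F, Λ < β) → ∀ h : L → Bool,
      ∃ α, (∀ β ∈ F, β < α) ∧ ∀ β ∈ F, c β α = h β := by
  by_contra hcon
  push Not at hcon
  choose F hF h hh using hcon
  obtain ⟨s, t, δ, h1, -, h3, h4⟩ := hc F h (fun _ => ∅) (fun t => {t}) (fun _ => Set.countable_empty)
    (fun _ => Set.countable_singleton _) (fun z => ⟨z, hF z, by simp⟩)
    (fun z => by
      obtain ⟨t, ht⟩ := hL.exists_gt hm z
      exact ⟨t, by rintro _ rfl; exact ht⟩)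
  obtain ⟨β, hβ, hne⟩ := hh s t fun β hβ => (h1 β hβ).trans (h3 t rfl)
  exact hne (h4 β hβ t rfl)

/-- The point of the Cantor cube given by the column of `c` at `α`: it agrees with `c` on the
coordinates in `(Λ, α)`, and is constantly `true` up to `Λ` and `false` from `α` on. -/
def column (c : L → L → Bool) (Λ α : L) : L → Bool := fun β =>
  if β ≤ Λ then true else if β < α then c β α else false

theorem column_of_le {c : L → L → Bool} {Λ α β : L} (h : β ≤ Λ) : column c Λ α β = true := if_pos h

theorem column_of_lt {c : L → L → Bool} {Λ α β : L} (h1 : Λ < β) (h2 : β < α) :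
    column c Λ α β = c β α := by
  rw [column, if_neg (not_le.2 h1), if_pos h2]

theorem column_of_ge {c : L → L → Bool} {Λ α β : L} (h1 : Λ < β) (h2 : α ≤ β) :
    column c Λ α β = false := by
  rw [column, if_neg (not_le.2 h1), if_neg (not_lt.2 h2)]

/-- The subspace of the Cantor cube consisting of the closures of all countable sets of columns,
together with the constant point `true`. -/
def columnSpace (c : L → L → Bool) (Λ : L) : Set (L → Bool) :=
  {x | x = (fun _ => true) ∨ ∃ b : Set L, b.Countable ∧ x ∈ closure (column c Λ '' b)}

variable {c : L → L → Bool} {Λ : L}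

theorem column_mem (α : L) : column c Λ α ∈ columnSpace c Λ :=
  Or.inr ⟨{α}, Set.countable_singleton α, subset_closure ⟨α, rfl, rfl⟩⟩

theorem eq_false_of_mem_closure {b : Set L} {β : L} (hβ : Λ < β) (hb : ∀ α ∈ b, α ≤ β)
    {x : L → Bool} (hx : x ∈ closure (column c Λ '' b)) : x β = false := by
  obtain ⟨_, ⟨α, hα, rfl⟩, h⟩ := mem_closure_iff_cylinder.1 hx {β}
  rw [← h β (Finset.mem_singleton_self β), column_of_ge hβ (hb α hα)]

theorem isCompact_closure_columnSpace (A : Set (columnSpace c Λ)) (hA : A.Countable) :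
    IsCompact (closure A) := by
  have h1 : ∀ x : columnSpace c Λ, ∃ b : Set L, b.Countable ∧
      (x.1 = (fun _ => true) ∨ x.1 ∈ closure (column c Λ '' b)) := by
    rintro ⟨x, hx | ⟨b, hb, hx⟩⟩
    · exact ⟨∅, Set.countable_empty, Or.inl hx⟩
    · exact ⟨b, hb, Or.inr hx⟩
  choose b hb hx using h1
  set b' : Set L := ⋃ x ∈ A, b x with hb'
  have hb'c : b'.Countable := hA.biUnion fun x _ => hb x
  set C : Set (L → Bool) := {fun _ => true} ∪ closure (column c Λ '' b') with hC
  have hCc : IsClosed C := isClosed_singleton.union isClosed_closure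
  have hCX : C ⊆ columnSpace c Λ := by
    rintro x (hx | hx)
    · exact Or.inl hx
    · exact Or.inr ⟨b', hb'c, hx⟩
  have hpre : IsCompact ((Subtype.val : columnSpace c Λ → L → Bool) ⁻¹' C) :=
    IsInducing.subtypeVal.isCompact_preimage' hCc.isCompact (by simpa using hCX)
  refine hpre.of_isClosed_subset isClosed_closure
    (closure_minimal (fun x hxA => ?_) (hCc.preimage continuous_subtype_val))
  rcases hx x with h | h
  · exact Or.inl h
  · exact Or.inr (closure_mono (Set.image_mono (Set.subset_biUnion_of_mem hxA)) h)

theorem exists_accPt_columnSpace {D : Set (columnSpace c Λ)} (hD : D.Infinite) :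
    ∃ x, AccPt x (𝓟 D) := by
  set D' := Set.range fun n => (hD.natEmbedding D n).1 with hD'
  have hinf : D'.Infinite := Set.infinite_range_of_injective
    (Subtype.val_injective.comp (hD.natEmbedding D).injective)
  obtain ⟨x, -, hx⟩ := hinf.exists_accPt_of_subset_isCompact
    (isCompact_closure_columnSpace D' (Set.countable_range _)) subset_closure
  refine ⟨x, hx.mono (principal_mono.2 ?_)⟩
  rintro _ ⟨n, rfl⟩
  exact (hD.natEmbedding D n).2

/-- The point that is `false` at a single coordinate `β₀ > Λ` is in the closure of the columns, but
every point in the closure of countably many columns vanishes eventually. -/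
theorem not_compactSpace_columnSpace {m : Cardinal.{v}} (hL : SuccLike L m) (hm : ℵ₀ ≤ m)
    (hΛ : ∀ F : Finset L, (∀ β ∈ F, Λ < β) → ∀ h : L → Bool,
      ∃ α, (∀ β ∈ F, β < α) ∧ ∀ β ∈ F, c β α = h β) : ¬ CompactSpace (columnSpace c Λ) := by
  classical
  intro hcomp
  have hclosed : IsClosed (columnSpace c Λ) := (isCompact_iff_compactSpace.2 hcomp).isClosed
  obtain ⟨β₀, hβ₀⟩ := hL.exists_gt hm Λ
  have hq : (fun β => decide (β ≠ β₀)) ∈ closure (columnSpace c Λ) := by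
    refine mem_closure_iff_cylinder.2 fun F => ?_
    obtain ⟨α, h1, h2⟩ := hΛ {β ∈ F | Λ < β} (by simp) fun β => decide (β ≠ β₀)
    refine ⟨_, column_mem α, fun β hβ => ?_⟩
    rcases le_or_gt β Λ with h | h
    · simp [column_of_le h, (h.trans_lt hβ₀).ne]
    · have hmem : β ∈ ({β ∈ F | Λ < β} : Finset L) := by simp [hβ, h]
      rw [column_of_lt h (h1 β hmem), h2 β hmem]
  rw [hclosed.closure_eq] at hq
  rcases hq with hq | ⟨b, hb, hq⟩
  · simpa using congrFun hq β₀
  · obtain ⟨η, hη⟩ := hL.bdd b (hb.le_aleph0.trans hm)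
    obtain ⟨β, hβ⟩ := hL.exists_gt hm (max η β₀)
    have hβη : η < β := (le_max_left _ _).trans_lt hβ
    have hββ₀ : β₀ < β := (le_max_right _ _).trans_lt hβ
    have := eq_false_of_mem_closure (hβ₀.trans hββ₀) (fun α hα => ((hη α hα).trans hβη).le) hq
    simp [hββ₀.ne'] at this

/-- The constant point `true`, which is not isolated but is not touched by any discrete set. -/
def columnSpace.top (c : L → L → Bool) (Λ : L) : columnSpace c Λ := ⟨fun _ => true, Or.inl rfl⟩

theorem not_isOpen_top {m : Cardinal.{v}} (hL : SuccLike L m) (hm : ℵ₀ ≤ m)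
    (hΛ : ∀ F : Finset L, (∀ β ∈ F, Λ < β) → ∀ h : L → Bool,
      ∃ α, (∀ β ∈ F, β < α) ∧ ∀ β ∈ F, c β α = h β) :
    ¬ IsOpen ({columnSpace.top c Λ} : Set (columnSpace c Λ)) := by
  classical
  intro ho
  obtain ⟨V, hV, hVp⟩ := isOpen_induced_iff.1 ho
  have hp : (columnSpace.top c Λ).1 ∈ V := by
    have : columnSpace.top c Λ ∈ Subtype.val ⁻¹' V := by rw [hVp]; rfl
    exact this
  obtain ⟨F, hF⟩ := exists_cylinder_subset hV hp
  obtain ⟨α, h1, h2⟩ := hΛ {β ∈ F | Λ < β} (by simp) fun _ => true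
  have hα : column c Λ α ∈ V := hF _ fun β hβ => by
    rcases le_or_gt β Λ with h | h
    · exact column_of_le h
    · have hmem : β ∈ ({β ∈ F | Λ < β} : Finset L) := by simp [hβ, h]
      rw [column_of_lt h (h1 β hmem), h2 β hmem]
      rfl
  have hα' : (⟨_, column_mem α⟩ : columnSpace c Λ) ∈ Subtype.val ⁻¹' V := hα
  rw [hVp] at hα'
  obtain ⟨β, hβ⟩ := hL.exists_gt hm (max Λ α)
  have h3 : column c Λ α β = true := congrFun (congrArg Subtype.val hα') β
  rw [column_of_ge ((le_max_left _ _).trans_lt hβ) ((le_max_right _ _).trans hβ.le)] at h3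
  exact Bool.false_ne_true h3

theorem not_accPt_top {M : Type v} [LinearOrder M] [WellFoundedLT M] [WellFoundedLT L]
    {k : Cardinal.{v}} (hk : ℵ₀ ≤ k) (hM : SuccLike M k) (hL : SuccLike L #M)
    (hc : RealisesPatterns c) {D : Set (columnSpace c Λ)} (hD : IsDiscrete D) :
    ¬ AccPt (columnSpace.top c Λ) (𝓟 D) := by
  classical
  intro hacc
  have hm : ℵ₀ ≤ #M := hk.trans hM.lt_mk.le
  have h1 : ∀ ξ : L, ∃ x ∈ D, x.1 ξ = true ∧ ∃ b : Set L, b.Countable ∧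
      (∀ α ∈ b, column c Λ α ξ = true) ∧ x.1 ∈ closure (column c Λ '' b) := by
    intro ξ
    have hU : {x : columnSpace c Λ | x.1 ξ = true} ∈ 𝓝 (columnSpace.top c Λ) :=
      (isOpen_coord_eq _ ξ true).mem_nhds rfl
    obtain ⟨x, ⟨hxξ, hxD⟩, hxp⟩ := accPt_iff_nhds.1 hacc _ hU
    refine ⟨x, hxD, hxξ, ?_⟩
    rcases x.2 with h | ⟨b, hb, hx⟩
    · exact absurd (Subtype.ext h) hxp
    · refine ⟨{α ∈ b | column c Λ α ξ = true}, hb.mono fun α hα => hα.1, fun α hα => hα.2, ?_⟩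
      refine mem_closure_iff_cylinder.2 fun F => ?_
      obtain ⟨_, ⟨α, hα, rfl⟩, h⟩ := mem_closure_iff_cylinder.1 hx (insert ξ F)
      exact ⟨_, ⟨α, ⟨hα, (h ξ (Finset.mem_insert_self _ _)).trans hxξ⟩, rfl⟩,
        fun β hβ => h β (Finset.mem_insert_of_mem hβ)⟩
  choose x hxD hxξ b hbc hbξ hxb using h1
  have hbgt : ∀ ξ, Λ < ξ → ∀ α ∈ b ξ, ξ < α := fun ξ hξ α hα => not_le.1 fun hle => by
    have := hbξ ξ α hα
    rw [column_of_ge hξ hle] at this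
    exact Bool.false_ne_true this
  have h2 : ∀ ξ, ∃ F : Finset L, ∀ y ∈ D, (∀ β ∈ F, y.1 β = (x ξ).1 β) → y = x ξ := by
    intro ξ
    obtain ⟨U, hU, hUD⟩ := isDiscrete_iff_forall_mem_exists_isOpen.1 hD (x ξ) (hxD ξ)
    obtain ⟨V, hV, rfl⟩ := isOpen_induced_iff.1 hU
    have hxV : x ξ ∈ Subtype.val ⁻¹' V ∩ D := by rw [hUD]; rfl
    obtain ⟨F, hF⟩ := exists_cylinder_subset hV hxV.1
    refine ⟨F, fun y hyD hy => ?_⟩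
    have : y ∈ Subtype.val ⁻¹' V ∩ D := ⟨hF y.1 hy, hyD⟩
    rw [hUD] at this
    exact this
  choose F hF using h2
  -- On a stationary set of `ξ`, the part below `ξ` of the condition isolating `x ξ` is constant.
  have : Nonempty L := hL.nonempty
  choose! r hr hr' using fun ξ (hξ : ξ ∈ HighCof L k) => hξ (({β ∈ F ξ | β < ξ} : Finset L) : Set L)
    ((Finset.countable_toSet _).le_aleph0.trans hk) (by simp)
  obtain ⟨Λ', hΛ'⟩ := (stationary_highCof hk hM hL).fodor hL hm r hr
  obtain ⟨⟨R, R'⟩, hR⟩ := hΛ'.exists_fiber hL (Q := Finset (Set.Iio Λ') × Finset (Set.Iio Λ'))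
    (by
      rw [← mul_def]
      have h3 := mk_finset_le_of_aleph0_le hm (hL.mk_Iio_le Λ')
      exact (mul_le_mul' h3 h3).trans (mul_eq_self hm).le)
    fun ξ => ({β ∈ F ξ | β < ξ}.subtype (· ∈ Set.Iio Λ'),
      {β ∈ F ξ | β < ξ ∧ (x ξ).1 β = true}.subtype (· ∈ Set.Iio Λ'))
  have hpat : ∀ ξ, ξ ∈ HighCof L k ∧ r ξ = Λ' → ∀ β ∈ F ξ, β < ξ → β < Λ' := by
    rintro ξ ⟨hξ, rfl⟩ β hβ hβξ
    exact hr' ξ hξ β (by simp [hβ, hβξ])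
  choose ξ hξ hξ' using hR.exists_gt fun δ hδ => HighCof.exists_lt hδ.1.1
  have hgt : ∀ z, z < ξ (max z Λ) := fun z => (le_max_left _ _).trans_lt (hξ' _)
  have hgtΛ : ∀ z, Λ < ξ (max z Λ) := fun z => (le_max_right _ _).trans_lt (hξ' _)
  have hE : ∀ z, ∃ t, ∀ y ∈ insert (ξ (max t Λ)) (b (ξ (max t Λ))), z < y := fun z => ⟨z, by
    rintro y (rfl | hy)
    · exact hgt z
    · exact (hgt z).trans (hbgt _ (hgtΛ z) y hy)⟩
  obtain ⟨s, t, δ, h3, h4, h5, h6⟩ := hc (fun s => {β ∈ F (ξ (max s Λ)) | ξ (max s Λ) ≤ β})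
    (fun s => (x (ξ (max s Λ))).1)
    (fun s => insert (ξ (max s Λ)) (b (ξ (max s Λ)))) (fun s => insert (ξ (max s Λ)) (b (ξ (max s Λ))))
    (fun s => (hbc _).insert _) (fun s => (hbc _).insert _)
    (fun z => ⟨z, fun y hy => (hgt z).trans_le (Finset.mem_filter.1 hy).2, by
      rintro y (rfl | hy)
      · exact hgt z
      · exact (hgt z).trans (hbgt _ (hgtΛ z) y hy)⟩) hE
  obtain ⟨hσ, hσ'⟩ := hξ (max s Λ)
  obtain ⟨hτ, hτ'⟩ := hξ (max t Λ)
  have hσΛ := hgtΛ s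
  have hτΛ := hgtΛ t
  generalize ξ (max s Λ) = σ at *
  generalize ξ (max t Λ) = τ at *
  have hστ : σ < τ := (h4 σ (Or.inl rfl)).trans (h5 τ (Or.inl rfl))
  have heq : x τ = x σ := by
    refine hF σ _ (hxD τ) fun β hβ => ?_
    rcases lt_or_ge β σ with hlt | hge
    · have hβΛ' := hpat σ hσ β hβ hlt
      have e1 := congrArg Prod.snd (hσ'.trans hτ'.symm)
      have e2 := Finset.ext_iff.1 e1 ⟨β, hβΛ'⟩
      have e3 := Finset.ext_iff.1 (congrArg Prod.fst (hσ'.trans hτ'.symm)) ⟨β, hβΛ'⟩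
      simp only [Finset.mem_subtype, Finset.mem_filter, hβ, hlt, hlt.trans hστ, true_and,
        and_true, true_iff] at e2 e3
      rw [Bool.eq_iff_iff]
      simp only [e3, true_and] at e2
      exact e2.symm
    · have hmem : β ∈ ({β ∈ F σ | σ ≤ β} : Finset L) := by simp [hβ, hge]
      obtain ⟨_, ⟨α, hα, rfl⟩, h⟩ := mem_closure_iff_cylinder.1 (hxb τ) {β}
      rw [← h β (Finset.mem_singleton_self β),
        column_of_lt (hσΛ.trans_le hge) ((h3 β hmem).trans (h5 α (Or.inr hα)))]
      exact h6 β hmem α (Or.inr hα)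
  have hfalse : (x σ).1 τ = false := eq_false_of_mem_closure hτΛ
    (fun α hα => ((h4 α (Or.inr hα)).trans (h5 τ (Or.inl rfl))).le) (hxb σ)
  rw [← heq, hxξ] at hfalse
  exact Bool.false_ne_true hfalse.symm

theorem topStar_aleph_three : TopStar.{u} (aleph 3) ℵ₀ := by
  have h0 : (ℵ₀ : Cardinal.{u}) ≤ Order.succ ℵ₀ := Order.le_succ _
  have h1 : (ℵ₀ : Cardinal.{u}) ≤ Order.succ (Order.succ ℵ₀) := h0.trans (Order.le_succ _)
  have hK := succLike_toType (c := (ℵ₀ : Cardinal.{u})) le_rfl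
  have hM : SuccLike (Order.succ (Order.succ (ℵ₀ : Cardinal.{u}))).ord.ToType
      #(Order.succ (ℵ₀ : Cardinal.{u})).ord.ToType := by
    rw [mk_ord_toType]; exact succLike_toType h0
  have hL : SuccLike (Order.succ (Order.succ (Order.succ (ℵ₀ : Cardinal.{u})))).ord.ToType
      #(Order.succ (Order.succ (ℵ₀ : Cardinal.{u}))).ord.ToType := by
    rw [mk_ord_toType]; exact succLike_toType h1
  have hM0 : (ℵ₀ : Cardinal.{u}) ≤ #(Order.succ (Order.succ (ℵ₀ : Cardinal.{u}))).ord.ToType := by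
    rw [mk_ord_toType]; exact h1
  have h3 : aleph 3 = Order.succ (Order.succ (Order.succ (ℵ₀ : Cardinal.{u}))) := by
    rw [← aleph_zero, succ_aleph, succ_aleph, succ_aleph]
    norm_num
  obtain ⟨c, hc⟩ := exists_realisesPatterns hK hM hL
  obtain ⟨Λ, hΛ⟩ := hc.exists_bound hL hM0
  refine ⟨columnSpace c Λ, inferInstance, ⟨inferInstance, isTopologicalBasis_isClopen _, ?_⟩,
    fun A hA => isCompact_closure_columnSpace A (le_aleph0_iff_set_countable.1 hA),
    fun D hD _ => exists_accPt_columnSpace hD, not_compactSpace_columnSpace hL hM0 hΛ,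
    columnSpace.top c Λ, not_isOpen_top hL hM0 hΛ,
    fun D hD => not_accPt_top (hK.lt_mk.le) hM hL hc hD⟩
  refine (weight_le (hM0.trans hL.lt_mk.le) _).trans ?_
  rw [mk_ord_toType, h3]

end Topology

end StrongColouring

theorem claim1p9 :
    (∀ κ lam : Cardinal.{u}, κ.IsRegular → lam = Order.succ (Order.succ (Order.succ κ)) →
      StrongColouring.Pr1 lam lam lam κ (Order.succ κ) ∧
      StrongColouring.Pr00 lam lam lam Cardinal.aleph0.{u} (Order.succ κ)) ∧
    StrongColouring.TopStar.{u} (Cardinal.aleph 3) Cardinal.aleph0.{u} := by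
  refine ⟨?_, StrongColouring.topStar_aleph_three⟩
  rintro κ _ hκ rfl
  exact ⟨StrongColouring.pr1_succ_succ_succ hκ.aleph0_le,
    StrongColouring.pr00_succ_succ_succ hκ.aleph0_le⟩
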